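/- Let $A$ be a totally ordered alphabet and $\mathbb K$ a field of characteristic $0$. A Lyndon–Shirshov word is a nonempty word in $A$ that is lexicographically smaller than all its nontrivial cyclic permutations. A simple partition of a word $u$ with first letter $\alpha$ is a factorization of $u$ into $\alpha$-simple words $\alpha^n\chi$ ($n\ge 0$, $\chi\neq\alpha$ a single letter), which are then regarded as the letters of a new word; every Lyndon–Shirshov word $w$ is turned into a single letter by a unique sequence of successive simple partitions. Following this nested partition, define recursively: * the left-greedy bracketing $\lfloor\lfloor w\rfloor\rfloor$, by $\lfloor\lfloor a\rfloor\rfloor=a$ for a letter $a\in A$ and $\lfloor\lfloor \alpha^n\chi\rfloor\rfloor=[\lfloor\lfloor\alpha\rfloor\rfloor,[\lfloor\lfloor\alpha\rfloor\rfloor,\dots[\lfloor\lfloor\alpha\rfloor\rfloor,\lfloor\lfloor\chi\rfloor\rfloor]\cdots]]$ ($n$ copies of $\lfloor\lfloor\alpha\rfloor\rfloor$); * the star graph $\bigstar(w)$, a finite directed graph with vertices labelled by letters and with an anchor vertex: $\bigstar(a)$ is a single anchor vertex labelled $a$, and $\bigstar(\alpha^n\chi)$ consists of $n$ disjoint copies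 of $\bigstar(\alpha)$ and one copy of $\bigstar(\chi)$, with an edge from the anchor of each $\bigstar(\alpha)$ to the anchor of $\bigstar(\chi)$, the latter being the anchor of $\bigstar(\alpha^n\chi)$. For a finite directed graph $G$ with vertices labelled in $A$ and a Lie bracket expression $L$ (a bracketing of a nonempty word in $A$) let $\langle G,L\rangle=\sum_\sigma\langle G,L\rangle_\sigma\in\mathbb Z$, the sum over all label-preserving bijections $\sigma$ from the vertices of $G$ to the positions of letters in $L$. Here $\langle G,L\rangle_\sigma=0$ if $L$ has a sub-bracket $[H,K]$ such that the full subgraphs of $G$ on $\sigma^{-1}H$ and $\sigma^{-1}K$ are not both connected (ignoring directions) with exactly one edge of $G$ between them; otherwise $\langle G,L\rangle_\sigma=(-1)^n$, where $n$ is the number of edges of $G$ that point from right to left in $L$ under $\sigma$. Then: 1. For Lyndon–Shirshov words $w,w'$, $\langle\bigstar(w),\lfloor\lfloor w'\rfloor\rfloor\rangle\neq 0$ if and only if $w=w'$. 2. For every Lie bracket expression $L$, only finitely many Lyndon–Shirshov words $w$ satisfy $\langle\bigstar(w),L\rangle\ne0$, and in the free Lie algebra over $\mathbb K$ on $A$ $$L=\sum_{w\text{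 a Lyndon–Shirshov word}}\frac{\langle\bigstar(w),L\rangle}{\langle\bigstar(w),\lfloor\lfloor w\rfloor\rfloor\rangle}\,\lfloor\lfloor w\rfloor\rfloor .$$ 3. In other words, the star graphs give a dual basis to the left-greedy basis: the elements $\lfloor\lfloor w\rfloor\rfloor$, $w$ Lyndon–Shirshov, form a linear basis of the free Lie algebra, each $\langle\bigstar(w),\cdot\rangle$ is a well-defined linear functional on the free Lie algebra, and the coordinate functional of $\lfloor\lfloor w\rfloor\rfloor$ in this basis is $\langle\bigstar(w),\cdot\rangle/\langle\bigstar(w),\lfloor\lfloor w\rfloor\rfloor\rangle$. -/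

import Mathlib

universe u v

namespace LeftGreedy

/-! ### Lyndon-Shirshov words -/

/-- A word is Lyndon-Shirshov if it is nonempty and lexicographically smaller than each of its
nontrivial cyclic permutations. (`<` on lists is the lexicographic order.) -/
def IsLyndon {A : Type u} [LinearOrder A] (w : List A) : Prop :=
  w ≠ [] ∧ ∀ k : ℕ, 0 < k → k < w.length → w < w.rotate k

/-- The type of Lyndon-Shirshov words in the alphabet `A`. -/
abbrev LyndonWord (A : Type u) [LinearOrder A] : Type u := {w : List A // IsLyndon w}

/-! ### Simple words and full partitions -/

/-- Letters of `A`, simple words in these, simple words of simple words, and so on: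
`simple α n χ` is the simple word `αⁿχ`, regarded as one new letter. -/
inductive NestedWord (A : Type u) : Type u
  | letter (a : A) : NestedWord A
  | simple (α : NestedWord A) (n : ℕ) (χ : NestedWord A) : NestedWord A

/-- The underlying word in the alphabet `A` (forgetting the nesting). -/
def NestedWord.word {A : Type u} : NestedWord A → List A
  | .letter a => [a]
  | .simple α n χ => (List.replicate n α.word).flatten ++ χ.word

/-- `IsSimplePartition u p`: the word `u`, with first letter `α`, is the concatenation
`(α ⋯ α χ₁)(α ⋯ α χ₂) ⋯ (α ⋯ α χₖ)` of `α`-simple words (so each `χᵢ ≠ α`; the numbers of `α`'s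
may be zero), and `p` is the word which has these `α`-simple words as its letters. -/
def IsSimplePartition {A : Type u} (u p : List (NestedWord A)) : Prop :=
  ∃ (α : NestedWord A) (parts : List (ℕ × NestedWord A)),
    u.head? = some α ∧
    (∀ q ∈ parts, q.2 ≠ α) ∧
    u = parts.flatMap (fun q => List.replicate q.1 α ++ [q.2]) ∧
    p = parts.map (fun q => NestedWord.simple α q.1 q.2)

/-- `IsFullPartition w N`: successive simple partitions lead from the word `w` to the trivial
coarse partition, whose only part is `N`. -/
def IsFullPartition {A : Type u} (w : List A) (N : NestedWord A) : Prop :=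
  Relation.ReflTransGen IsSimplePartition (w.map NestedWord.letter) [N]

/-! Every Lyndon-Shirshov word has exactly one full partition. -/

theorem NestedWord.word_ne_nil {A : Type u} (N : NestedWord A) : N.word ≠ [] := by
  induction N with
  | letter a => simp [NestedWord.word]
  | simple α n χ _ h => simp [NestedWord.word, h]

theorem IsLyndon.no_border {A : Type u} [LinearOrder A] {x y : List A} (hx : x ≠ [])
    (h : IsLyndon (x ++ (y ++ x))) : False := by
  have hl : 0 < x.length := List.length_pos_iff.2 hx
  have h1 := h.2 x.length hl (by simp; omega)
  rw [List.rotate_append_length_eq] at h1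
  have h2 := h.2 (x ++ y).length (by simp; omega) (by simp; omega)
  rw [← List.append_assoc, List.rotate_append_length_eq] at h2
  have h3 : y ++ x < x ++ y := by
    by_contra hc
    rcases lt_or_eq_of_le (not_lt.1 hc) with hlt | heq
    · have h4 : x ++ (x ++ y) < x ++ (y ++ x) := List.append_left_lt hlt
      rw [List.append_assoc] at h2
      exact lt_asymm h2 h4
    · rw [List.append_assoc, heq] at h2
      exact lt_irrefl _ h2
  have h4 : (y ++ x) ++ x < (x ++ y) ++ x := by
    have key : ∀ s t : List A, s.length = t.length → s < t → s ++ x < t ++ x := by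
      intro s
      induction s with
      | nil => intro t ht hlt; cases t with
        | nil => exact absurd hlt (lt_irrefl _)
        | cons b t => simp at ht
      | cons a s ih =>
        intro t ht hlt
        cases t with
        | nil => simp at ht
        | cons b t =>
          rw [List.cons_append, List.cons_append, List.cons_lt_cons_iff]
          rcases List.cons_lt_cons_iff.1 hlt with hab | ⟨hab, hst⟩
          · exact Or.inl hab
          · exact Or.inr ⟨hab, ih t (by simpa using ht) hst⟩
    exact key _ _ (by simp [add_comm]) h3
  rw [← List.append_assoc] at h1
  exact lt_asymm h1 h4

theorem exists_parts {A : Type u} (α : NestedWord A) (u : List (NestedWord A))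
    (hu : u.getLast? ≠ some α) :
    ∃ parts : List (ℕ × NestedWord A), (∀ q ∈ parts, q.2 ≠ α) ∧
      u = parts.flatMap (fun q => List.replicate q.1 α ++ [q.2]) := by
  induction u with
  | nil => exact ⟨[], by simp, by simp⟩
  | cons x l ih =>
    rcases List.eq_nil_or_concat l with rfl | ⟨l', z, hl⟩
    · refine ⟨[(0, x)], ?_, by simp⟩
      simpa using hu
    · have hl0 : l ≠ [] := by simp [hl]
      obtain ⟨parts, h1, h2⟩ := ih (by
        rw [List.getLast?_cons] at hu
        subst hl
        simpa using hu)
      by_cases hx : x = α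
      · subst hx
        cases parts with
        | nil => exact absurd h2 (by simpa using hl0)
        | cons q ps =>
          refine ⟨(q.1 + 1, q.2) :: ps, ?_, ?_⟩
          · intro r hr
            rcases List.mem_cons.1 hr with rfl | hr
            · exact h1 q (by simp)
            · exact h1 r (by simp [hr])
          · rw [h2]
            simp [List.replicate_succ]
      · refine ⟨(0, x) :: parts, ?_, ?_⟩
        · intro r hr
          rcases List.mem_cons.1 hr with rfl | hr
          · exact hx
          · exact h1 r hr
        · rw [List.flatMap_cons, ← h2]
          simp

theorem length_parts_le {A : Type u} (α : NestedWord A) (parts : List (ℕ × NestedWord A)) :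
    parts.length ≤ (parts.flatMap (fun q => List.replicate q.1 α ++ [q.2])).length := by
  induction parts with
  | nil => simp
  | cons q ps ih =>
    simp only [List.flatMap_cons, List.length_append, List.length_cons, List.length_nil,
      List.length_replicate]
    omega

theorem flatMap_word_parts {A : Type u} (α : NestedWord A) (parts : List (ℕ × NestedWord A)) :
    (parts.map (fun q => NestedWord.simple α q.1 q.2)).flatMap NestedWord.word =
      (parts.flatMap (fun q => List.replicate q.1 α ++ [q.2])).flatMap NestedWord.word := by
  induction parts with
  | nil => simp
  | cons q ps ih =>
    simp only [List.map_cons, List.flatMap_cons, List.flatMap_append, ih]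
    simp [NestedWord.word, List.flatMap_def]

theorem exists_simple_partitions {A : Type u} [LinearOrder A] (m : ℕ) :
    ∀ u : List (NestedWord A), u.length = m → IsLyndon (u.flatMap NestedWord.word) →
      ∃ N, Relation.ReflTransGen IsSimplePartition u [N] := by
  induction m using Nat.strong_induction_on with
  | _ m ih =>
    intro u hm hL
    match u, hm, hL with
    | [], _, hL => exact absurd rfl hL.1
    | [N], _, _ => exact ⟨N, Relation.ReflTransGen.refl⟩
    | α :: x :: l, hm, hL =>
      have hlast : (α :: x :: l).getLast? ≠ some α := by
        intro hc
        rcases List.eq_nil_or_concat (x :: l) with h0 | ⟨l', z, hl⟩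
        · simp at h0
        · rw [hl] at hc hL
          have hz : z = α := by simpa [List.getLast?_cons] using hc
          subst hz
          simp only [List.concat_eq_append, List.flatMap_cons, List.flatMap_append,
            List.flatMap_nil, List.append_nil] at hL
          exact hL.no_border z.word_ne_nil
      obtain ⟨parts, h1, h2⟩ := exists_parts α _ hlast
      have hlen : parts.length < m := by
        rw [← hm]
        cases parts with
        | nil => simp
        | cons q ps =>
          have hq : q.1 ≠ 0 := by
            intro h0
            rw [List.flatMap_cons, h0] at h2
            simp only [List.replicate_zero, List.nil_append, List.cons_append,
              List.cons.injEq] at h2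
            exact h1 q (by simp) h2.1.symm
          have h3 := length_parts_le α ps
          rw [h2]
          simp only [List.flatMap_cons, List.length_append, List.length_cons, List.length_nil,
            List.length_replicate]
          omega
      obtain ⟨N, hN⟩ := ih parts.length hlen
        (parts.map (fun q => NestedWord.simple α q.1 q.2)) (by simp)
        (by rw [flatMap_word_parts, ← h2]; exact hL)
      exact ⟨N, Relation.ReflTransGen.head ⟨α, parts, rfl, h1, h2, rfl⟩ hN⟩

theorem IsLyndon.exists_fullPartition {A : Type u} [LinearOrder A] {w : List A}
    (hw : IsLyndon w) : ∃ N, IsFullPartition w N := by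
  refine exists_simple_partitions _ (w.map NestedWord.letter) rfl ?_
  have : (w.map NestedWord.letter).flatMap NestedWord.word = w := by
    rw [List.flatMap_map]
    simp [NestedWord.word]
  rwa [this]

theorem parts_unique {A : Type u} (α : NestedWord A) :
    ∀ p q : List (ℕ × NestedWord A), (∀ r ∈ p, r.2 ≠ α) → (∀ r ∈ q, r.2 ≠ α) →
      p.flatMap (fun r => List.replicate r.1 α ++ [r.2]) =
        q.flatMap (fun r => List.replicate r.1 α ++ [r.2]) → p = q := by
  intro p
  induction p with
  | nil =>
    intro q _ _ h
    cases q with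
    | nil => rfl
    | cons b q => simp at h
  | cons a p ih =>
    intro q hp hq h
    cases q with
    | nil => simp at h
    | cons b q =>
      obtain ⟨n, x⟩ := a
      obtain ⟨k, y⟩ := b
      have hx : x ≠ α := hp (n, x) (by simp)
      have hy : y ≠ α := hq (k, y) (by simp)
      have key : ∀ (n k : ℕ) (s t : List (NestedWord A)),
          List.replicate n α ++ x :: s = List.replicate k α ++ y :: t →
            n = k ∧ x = y ∧ s = t := by
        intro n
        induction n with
        | zero =>
          intro k s t h
          cases k with
          | zero => simpa using h
          | succ k => exact absurd (by simpa [List.replicate_succ] using (List.cons.inj h).1) hx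
        | succ n ihn =>
          intro k s t h
          cases k with
          | zero =>
            exact absurd (by simpa [List.replicate_succ] using (List.cons.inj h).1.symm) hy
          | succ k =>
            simp only [List.replicate_succ, List.cons_append, List.cons.injEq, true_and] at h
            obtain ⟨h1, h2⟩ := ihn k s t h
            exact ⟨by omega, h2⟩
      simp only [List.flatMap_cons, List.append_assoc, List.cons_append, List.nil_append] at h
      obtain ⟨h1, h2, h3⟩ := key n k _ _ h
      rw [h1, h2, ih q (fun r hr => hp r (by simp [hr])) (fun r hr => hq r (by simp [hr])) h3]

theorem IsSimplePartition.unique {A : Type u} {u p q : List (NestedWord A)}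
    (hp : IsSimplePartition u p) (hq : IsSimplePartition u q) : p = q := by
  obtain ⟨α, s, h1, h2, h3, rfl⟩ := hp
  obtain ⟨β, t, k1, k2, k3, rfl⟩ := hq
  obtain rfl : α = β := Option.some.inj (h1.symm.trans k1)
  rw [parts_unique α s t h2 k2 (h3.symm.trans k3)]

theorem not_isSimplePartition_singleton {A : Type u} (N : NestedWord A)
    (p : List (NestedWord A)) : ¬ IsSimplePartition [N] p := by
  rintro ⟨α, parts, h1, h2, h3, -⟩
  obtain rfl : N = α := by simpa using h1
  have hlast : ∃ q ∈ parts, q.2 = N := by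
    rcases List.eq_nil_or_concat parts with rfl | ⟨l, q, rfl⟩
    · simp at h3
    · refine ⟨q, by simp, ?_⟩
      have := congrArg List.getLast? h3
      simpa using this.symm
  obtain ⟨q, hq, hqN⟩ := hlast
  exact h2 q hq hqN

theorem IsFullPartition.unique {A : Type u} {w : List A} {M N : NestedWord A}
    (hM : IsFullPartition w M) (hN : IsFullPartition w N) : M = N := by
  unfold IsFullPartition at hM hN
  generalize w.map NestedWord.letter = u at hM hN
  induction hM using Relation.ReflTransGen.head_induction_on with
  | refl =>
    rcases Relation.ReflTransGen.cases_head hN with h | ⟨c, h, -⟩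
    · simpa using h
    · exact absurd h (not_isSimplePartition_singleton _ _)
  | head h _ ih =>
    rcases Relation.ReflTransGen.cases_head hN with h' | ⟨c, h', hc⟩
    · subst h'
      exact absurd h (not_isSimplePartition_singleton _ _)
    · rw [IsSimplePartition.unique h' h] at hc
      exact ih hc

/-- The full partition of a Lyndon-Shirshov word. -/
noncomputable def fullPartition {A : Type u} [LinearOrder A] (w : LyndonWord A) : NestedWord A :=
  w.2.exists_fullPartition.choose

theorem fullPartition_spec {A : Type u} [LinearOrder A] (w : LyndonWord A) :
    IsFullPartition w.1 (fullPartition w) :=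
  w.2.exists_fullPartition.choose_spec

/-! ### Lie bracket expressions

A Lie bracket expression is an element of the free magma on the alphabet: `H * K` stands for the
bracket expression `[H, K]`. -/

/-- The element of the free Lie algebra represented by a Lie bracket expression. -/
noncomputable def toLie (K : Type v) [CommRing K] {A : Type u} :
    FreeMagma A → FreeLieAlgebra K A
  | .of a => FreeLieAlgebra.of K a
  | .mul L M => ⁅toLie K L, toLie K M⁆

/-- Left-greedy bracketing of a nested word:
`αⁿχ` is bracketed as `[α, [α, … [α, χ] … ]]`, recursively. -/
def NestedWord.bracket {A : Type u} : NestedWord A → FreeMagma A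
  | .letter a => .of a
  | .simple α n χ => (fun e => .mul α.bracket e)^[n] χ.bracket

/-- The left-greedy bracketing of a Lyndon-Shirshov word. -/
noncomputable def leftGreedy {A : Type u} [LinearOrder A] (w : LyndonWord A) : FreeMagma A :=
  (fullPartition w).bracket

/-! ### Star graphs -/

/-- A finite directed graph whose vertices are labelled by letters. -/
structure LetterGraph (A : Type u) where
  V : Type
  finite : Finite V
  graph : Digraph V
  label : V → A

/-- A finite directed graph labelled by letters, with a distinguished anchor vertex. -/
structure AnchoredGraph (A : Type u) extends LetterGraph A where
  anchor : V

/-- The graph with a single vertex. -/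
def AnchoredGraph.single {A : Type u} (a : A) : AnchoredGraph A where
  V := Unit
  finite := inferInstance
  graph := ⟨fun _ _ => False⟩
  label := fun _ => a
  anchor := ()

/-- `n` disjoint copies of `G` and one copy of `H`, with an edge from the anchor of each copy of
`G` to the anchor of `H`; the anchor is that of `H`. -/
def AnchoredGraph.attach {A : Type u} (G : AnchoredGraph A) (n : ℕ) (H : AnchoredGraph A) :
    AnchoredGraph A where
  V := (Fin n × G.V) ⊕ H.V
  finite := by
    have := G.finite
    have := H.finite
    infer_instance
  graph := ⟨fun
    | .inl (i, x), .inl (j, y) => i = j ∧ G.graph.Adj x y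
    | .inl (_, x), .inr y => x = G.anchor ∧ y = H.anchor
    | .inr _, .inl _ => False
    | .inr x, .inr y => H.graph.Adj x y⟩
  label := Sum.elim (fun x => G.label x.2) H.label
  anchor := .inr H.anchor

/-- The star graph of a nested word. -/
def NestedWord.star {A : Type u} : NestedWord A → AnchoredGraph A
  | .letter a => .single a
  | .simple α n χ => α.star.attach n χ.star

/-- The star graph of a Lyndon-Shirshov word. -/
noncomputable def starGraph {A : Type u} [LinearOrder A] (w : LyndonWord A) : LetterGraph A :=
  (fullPartition w).star.toLetterGraph

/-! ### The configuration pairing -/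

/-- The positions in a Lie bracket expression. -/
@[reducible] def Pos {A : Type u} : FreeMagma A → Type
  | .of _ => Unit
  | .mul H K => Pos H ⊕ Pos K

theorem Pos.finite {A : Type u} (L : FreeMagma A) : Finite (Pos L) := by
  induction L with
  | ih1 a => exact inferInstanceAs (Finite Unit)
  | ih2 H K hH hK => exact inferInstanceAs (Finite (Pos H ⊕ Pos K))

/-- The letter at a position. -/
def letterAt {A : Type u} : (L : FreeMagma A) → Pos L → A
  | .of a, _ => a
  | .mul H _, .inl p => letterAt H p
  | .mul _ K, .inr p => letterAt K p

/-- `LeftOf L p q`: the position `p` is strictly to the left of the position `q` in `L`. -/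
def LeftOf {A : Type u} : (L : FreeMagma A) → Pos L → Pos L → Prop
  | .of _, _, _ => False
  | .mul H _, .inl p, .inl q => LeftOf H p q
  | .mul _ _, .inl _, .inr _ => True
  | .mul _ _, .inr _, .inl _ => False
  | .mul _ K, .inr p, .inr q => LeftOf K p q

/-- `IsSubBracket L S T`: there is a sub-bracket expression `[H, K]` in `L` (possibly `L` itself)
such that `S` is the set of positions of `H` and `T` is the set of positions of `K`. -/
def IsSubBracket {A : Type u} : (L : FreeMagma A) → Set (Pos L) → Set (Pos L) → Prop
  | .of _, _, _ => False
  | .mul H K, S, T =>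
      (S = Set.range (Sum.inl : Pos H → Pos H ⊕ Pos K) ∧
        T = Set.range (Sum.inr : Pos K → Pos H ⊕ Pos K)) ∨
      (∃ S' T', IsSubBracket H S' T' ∧
        S = (Sum.inl : Pos H → Pos H ⊕ Pos K) '' S' ∧
        T = (Sum.inl : Pos H → Pos H ⊕ Pos K) '' T') ∨
      (∃ S' T', IsSubBracket K S' T' ∧
        S = (Sum.inr : Pos K → Pos H ⊕ Pos K) '' S' ∧
        T = (Sum.inr : Pos K → Pos H ⊕ Pos K) '' T')

/-- Bijections from the vertices of `G` to the positions in `L`, compatible with labels and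
letters. -/
abbrev Bij {A : Type u} (G : LetterGraph A) (L : FreeMagma A) : Type :=
  {σ : G.V ≃ Pos L // ∀ x, letterAt L (σ x) = G.label x}

instance {A : Type u} (G : LetterGraph A) (L : FreeMagma A) : Finite (Bij G L) := by
  have := G.finite
  have := Pos.finite L
  infer_instance

/-- The full subgraph on a set of vertices is connected (ignoring edge directions). -/
def ConnectedOn {A : Type u} (G : LetterGraph A) (S : Set G.V) : Prop :=
  (G.graph.toSimpleGraphInclusive.induce S).Connected

/-- There is exactly one edge of `G` (in either direction) between the vertex sets `S`, `T`. -/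
def OneEdgeBetween {A : Type u} (G : LetterGraph A) (S T : Set G.V) : Prop :=
  ∃! e : G.V × G.V, G.graph.Adj e.1 e.2 ∧ ((e.1 ∈ S ∧ e.2 ∈ T) ∨ (e.1 ∈ T ∧ e.2 ∈ S))

/-- The number of edges of `G` which move leftwards in `L` under `σ`. -/
noncomputable def leftwardEdges {A : Type u} (G : LetterGraph A) (L : FreeMagma A)
    (σ : Bij G L) : ℕ :=
  {e : G.V × G.V | G.graph.Adj e.1 e.2 ∧ LeftOf L (σ.1 e.2) (σ.1 e.1)}.ncard

open Classical in
/-- The `σ`-configuration pairing of a graph and a Lie bracket expression. -/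
noncomputable def pairingAt {A : Type u} (G : LetterGraph A) (L : FreeMagma A)
    (σ : Bij G L) : ℤ :=
  if ∃ S T, IsSubBracket L S T ∧
      ¬ (ConnectedOn G (σ.1 ⁻¹' S) ∧ ConnectedOn G (σ.1 ⁻¹' T) ∧
          OneEdgeBetween G (σ.1 ⁻¹' S) (σ.1 ⁻¹' T))
  then 0
  else (-1) ^ leftwardEdges G L σ

/-- The configuration pairing of a graph and a Lie bracket expression: the (finite) sum of the
`σ`-configuration pairings over all bijections `σ`. -/
noncomputable def pairing {A : Type u} (G : LetterGraph A) (L : FreeMagma A) : ℤ :=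
  ∑ᶠ σ : Bij G L, pairingAt G L σ

end LeftGreedy

open LeftGreedy

/-! Two facts carry the theorem.

The pairing descends to the free Lie algebra. Grouping the bijections by the way the outermost
bracket cuts the vertex set turns the pairing with `[H, K]` into a recursion: cut a vertex set into
two parts joined by exactly one edge, with the sign of that edge. This recursion is a bracket on
functions of vertex sets (`VertexFun`), and `link_jacobi` is its Jacobi identity. The universal
property then yields `pairingHom`, while `pairing_eq_subPairing` identifies the recursion with the
pairing defined by bijections.

Everything is compatible with eliminating the smallest letter `α`. A Lyndon-Shirshov word of length
at least two that begins with `α` is a word in the blocks `αⁿχ`, `α < χ`, and in a suitable order of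
the blocks it is again Lyndon-Shirshov (`isLyndon_flat_iff`), with the corresponding full partition
(`isFullPartition_flat`). Going back to the old alphabet hangs `n` leaves on each vertex of the star
graph and substitutes `[α, … [α, χ] … ]` for each letter of the bracketing. This multiplies the
pairing by a product of factorials (`IsBlowUp.subPairing_fibers`): no outer cut separates a leaf
from its anchor, and a star with `n` leaves matches its own bracket in `n!` ways, all of sign `+1`.
Induction on the length gives diagonality (`pairing_ne_zero_iff`), hence linear independence.

Spanning comes from the same elimination: the Lie subalgebra generated by the blocks is stable under
`ad α` (`of_lie_mem`), so a bracket expression with smallest letter `α`, other than `α` itself, is a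
combination of expressions with fewer letters, these being blocks. Pairing with the star graphs then
reads off coordinates in the resulting basis. -/

namespace LeftGreedy

/-! ### Signed edge counts between vertex sets and their Jacobi identity. -/

section Link
variable {V : Type} (adj : V → V → Prop)

open Classical in
/-- The number of edges from `S` to `T`. -/
noncomputable def arrows (S T : Finset V) : ℕ :=
  ∑ x ∈ S, ∑ y ∈ T, if adj x y then 1 else 0

/-- The sign of the only edge, if there are `a` edges in one direction and `b` in the other. -/
def linkSign (a b : ℕ) : ℤ := if a + b = 1 then (a : ℤ) - b else 0

open Classical in
/-- The sign of the only edge between disjoint sets of vertices; zero if there is not exactly one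
edge or if the sets meet. -/
noncomputable def link (S T : Finset V) : ℤ :=
  if Disjoint S T then linkSign (arrows adj S T) (arrows adj T S) else 0

theorem linkSign_comm (a b : ℕ) : linkSign a b = -linkSign b a := by
  unfold linkSign
  split_ifs <;> omega

/-- Here `(a, a')`, `(b, b')`, `(c, c')` count the edges in both directions between `T, U`, between
`T, W` and between `U, W`. Every term involves all three pairs, so a pair with two or more edges
kills everything. Otherwise a nonzero term needs exactly two pairs to be joined, and then two of the
three terms survive and balance. -/
theorem linkSign_jacobi (a a' b b' c c' : ℕ) :
    linkSign (a + b) (a' + b') * linkSign c c' =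
      linkSign (b + c) (b' + c') * linkSign a a' + linkSign (a' + c) (a + c') * linkSign b b' := by
  have zero : ∀ x y : ℕ, 2 ≤ x + y → linkSign x y = 0 := by
    intro x y h
    exact if_neg (by omega)
  rcases le_or_gt 2 (a + a') with h | h
  · rw [zero _ _ (by omega : 2 ≤ (a + b) + (a' + b')), zero a a' h,
      zero _ _ (by omega : 2 ≤ (a' + c) + (a + c'))]
    simp
  rcases le_or_gt 2 (b + b') with h1 | h1
  · rw [zero _ _ (by omega : 2 ≤ (a + b) + (a' + b')), zero b b' h1,
      zero _ _ (by omega : 2 ≤ (b + c) + (b' + c'))]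
    simp
  rcases le_or_gt 2 (c + c') with h2 | h2
  · rw [zero _ _ (by omega : 2 ≤ (b + c) + (b' + c')), zero c c' h2,
      zero _ _ (by omega : 2 ≤ (a' + c) + (a + c'))]
    simp
  have ha : a ≤ 1 := by omega
  have ha' : a' ≤ 1 := by omega
  have hb : b ≤ 1 := by omega
  have hb' : b' ≤ 1 := by omega
  have hc : c ≤ 1 := by omega
  have hc' : c' ≤ 1 := by omega
  interval_cases a <;> interval_cases a' <;> interval_cases b <;> interval_cases b' <;>
    interval_cases c <;> interval_cases c' <;> simp_all [linkSign]

theorem link_comm (S T : Finset V) : link adj S T = -link adj T S := by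
  unfold link
  by_cases h : Disjoint S T
  · rw [if_pos h, if_pos h.symm, linkSign_comm]
  · rw [if_neg h, if_neg (fun h' => h h'.symm), neg_zero]

open Classical in
theorem arrows_union_left {S T : Finset V} (h : Disjoint S T) (U : Finset V) :
    arrows adj (S ∪ T) U = arrows adj S U + arrows adj T U :=
  Finset.sum_union h

open Classical in
theorem arrows_union_right {S T : Finset V} (h : Disjoint S T) (U : Finset V) :
    arrows adj U (S ∪ T) = arrows adj U S + arrows adj U T := by
  unfold arrows
  rw [← Finset.sum_add_distrib]
  exact Finset.sum_congr rfl fun x _ => Finset.sum_union h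

open Classical in
theorem link_jacobi (T U W : Finset V) :
    link adj T (U ∪ W) * link adj U W =
      link adj (T ∪ U) W * link adj T U + link adj U (T ∪ W) * link adj T W := by
  by_cases hTU : Disjoint T U
  · by_cases hTW : Disjoint T W
    · by_cases hUW : Disjoint U W
      · have h1 : Disjoint T (U ∪ W) := Finset.disjoint_union_right.2 ⟨hTU, hTW⟩
        have h2 : Disjoint (T ∪ U) W := Finset.disjoint_union_left.2 ⟨hTW, hUW⟩
        have h3 : Disjoint U (T ∪ W) := Finset.disjoint_union_right.2 ⟨hTU.symm, hUW⟩
        simp only [link, if_pos h1, if_pos h2, if_pos h3, if_pos hTU, if_pos hTW, if_pos hUW,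
          arrows_union_left adj hTU, arrows_union_right adj hTU, arrows_union_left adj hTW,
          arrows_union_right adj hTW, arrows_union_left adj hUW, arrows_union_right adj hUW]
        exact linkSign_jacobi _ _ _ _ _ _
      · simp [link, hUW]
    · simp [link, hTW]
  · have : ¬ Disjoint U T := fun h => hTU h.symm
    simp [link, hTU, this]

theorem arrows_eq_zero_iff {S T : Finset V} :
    arrows adj S T = 0 ↔ ∀ x ∈ S, ∀ y ∈ T, ¬ adj x y := by
  simp [arrows]

end Link

/-! ### The Lie algebra of functions on vertex sets. -/

section Pairing
variable {V : Type}

/-- Functions on the sets of vertices of a graph. -/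
def VertexFun (_adj : V → V → Prop) (K : Type*) : Type _ := Finset V → K

end Pairing

namespace VertexFun
variable {V : Type} {adj : V → V → Prop} {K : Type*} [Field K]

instance : AddCommGroup (VertexFun adj K) := inferInstanceAs (AddCommGroup (Finset V → K))
instance : Module K (VertexFun adj K) := inferInstanceAs (Module K (Finset V → K))

theorem add_apply (f g : VertexFun adj K) (S : Finset V) : (f + g) S = f S + g S := rfl

theorem smul_apply (c : K) (f : VertexFun adj K) (S : Finset V) : (c • f) S = c * f S := rfl

variable [Fintype V]

open Classical in
/-- Cutting a set of vertices in two parts joined by exactly one edge. -/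
noncomputable instance : Bracket (VertexFun adj K) (VertexFun adj K) where
  bracket f g := fun S =>
    ∑ T : Finset V, ∑ U : Finset V, if T ∪ U = S then (link adj T U : K) * (f T * g U) else 0

open Classical in
theorem lie_apply (f g : VertexFun adj K) (S : Finset V) :
    ⁅f, g⁆ S = ∑ T : Finset V, ∑ U : Finset V,
      if T ∪ U = S then (link adj T U : K) * (f T * g U) else 0 := rfl

theorem lie_swap (f g : VertexFun adj K) (S : Finset V) : ⁅f, g⁆ S = -⁅g, f⁆ S := by
  classical
  rw [lie_apply, lie_apply, Finset.sum_comm, ← Finset.sum_neg_distrib]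
  refine Finset.sum_congr rfl fun T _ => ?_
  rw [← Finset.sum_neg_distrib]
  refine Finset.sum_congr rfl fun U _ => ?_
  rw [link_comm adj U T, Finset.union_comm U T]
  split_ifs
  · push_cast
    ring
  · simp

open Classical in
-- The intermediate set `R` in the outer cut is forced to be `U ∪ W`, so its sum collapses and the
-- triple `(T, U, W)` remains.
theorem lie_lie_apply (f g h : VertexFun adj K) (S : Finset V) :
    ⁅f, ⁅g, h⁆⁆ S = ∑ T : Finset V, ∑ U : Finset V, ∑ W : Finset V,
      if T ∪ (U ∪ W) = S then
        ((link adj T (U ∪ W) * link adj U W : ℤ) : K) * (f T * g U * h W) else 0 := by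
  rw [lie_apply]
  refine Finset.sum_congr rfl fun T _ => ?_
  have h1 : ∀ R : Finset V,
      (if T ∪ R = S then (link adj T R : K) * (f T * ⁅g, h⁆ R) else 0) =
        ∑ U : Finset V, ∑ W : Finset V, if U ∪ W = R then
          (if T ∪ R = S then
            ((link adj T R * link adj U W : ℤ) : K) * (f T * g U * h W) else 0) else 0 := by
    intro R
    split_ifs with hR
    · rw [lie_apply, Finset.mul_sum, Finset.mul_sum]
      refine Finset.sum_congr rfl fun U _ => ?_
      rw [Finset.mul_sum, Finset.mul_sum]
      refine Finset.sum_congr rfl fun W _ => ?_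
      split_ifs
      · push_cast
        ring
      · ring
    · simp
  rw [Finset.sum_congr rfl fun R _ => h1 R, Finset.sum_comm]
  refine Finset.sum_congr rfl fun U _ => ?_
  rw [Finset.sum_comm]
  refine Finset.sum_congr rfl fun W _ => ?_
  simp

theorem leibniz (f g h : VertexFun adj K) : ⁅f, ⁅g, h⁆⁆ = ⁅⁅f, g⁆, h⁆ + ⁅g, ⁅f, h⁆⁆ := by
  classical
  funext S
  rw [add_apply, lie_swap ⁅f, g⁆ h, lie_lie_apply, lie_lie_apply, lie_lie_apply]
  -- The summation orders are permuted until in all three double brackets `f`, `g`, `h` are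
  -- evaluated at `T`, `U`, `W`; then `link_jacobi` applies term by term.
  have h1 : ∀ F : Finset V → Finset V → Finset V → K,
      ∑ T, ∑ U, ∑ W, F T U W = ∑ U, ∑ W, ∑ T, F T U W := by
    intro F
    rw [Finset.sum_comm]
    exact Finset.sum_congr rfl fun U _ => Finset.sum_comm
  rw [h1 (fun W T U => if W ∪ (T ∪ U) = S then
    ((link adj W (T ∪ U) * link adj T U : ℤ) : K) * (h W * f T * g U) else 0)]
  rw [Finset.sum_comm (f := fun U T => ∑ W, if U ∪ (T ∪ W) = S then
    ((link adj U (T ∪ W) * link adj T W : ℤ) : K) * (g U * f T * h W) else 0)]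
  rw [← Finset.sum_neg_distrib, ← Finset.sum_add_distrib]
  refine Finset.sum_congr rfl fun T _ => ?_
  rw [← Finset.sum_neg_distrib, ← Finset.sum_add_distrib]
  refine Finset.sum_congr rfl fun U _ => ?_
  rw [← Finset.sum_neg_distrib, ← Finset.sum_add_distrib]
  refine Finset.sum_congr rfl fun W _ => ?_
  have e1 : W ∪ (T ∪ U) = T ∪ (U ∪ W) := by rw [Finset.union_comm, Finset.union_assoc]
  have e2 : U ∪ (T ∪ W) = T ∪ (U ∪ W) := Finset.union_left_comm _ _ _
  rw [e1, e2, link_jacobi adj T U W, link_comm adj W (T ∪ U)]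
  split_ifs
  · push_cast
    ring
  · simp

variable [CharZero K]

noncomputable instance : LieRing (VertexFun adj K) where
  add_lie f g h := by
    classical
    funext S
    simp only [lie_apply, add_apply, ← Finset.sum_add_distrib]
    refine Finset.sum_congr rfl fun T _ => Finset.sum_congr rfl fun U _ => ?_
    split_ifs
    · ring
    · simp
  lie_add f g h := by
    classical
    funext S
    simp only [lie_apply, add_apply, ← Finset.sum_add_distrib]
    refine Finset.sum_congr rfl fun T _ => Finset.sum_congr rfl fun U _ => ?_
    split_ifs
    · ring
    · simp
  -- Antisymmetry gives the vanishing of squares because `2 ≠ 0` in `K`.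
  lie_self f := funext fun S => self_eq_neg.1 (lie_swap f f S)
  leibniz_lie := leibniz

noncomputable instance : LieAlgebra K (VertexFun adj K) where
  lie_smul c f g := by
    classical
    funext S
    rw [smul_apply, lie_apply, lie_apply, Finset.mul_sum]
    refine Finset.sum_congr rfl fun T _ => ?_
    rw [Finset.mul_sum]
    refine Finset.sum_congr rfl fun U _ => ?_
    rw [smul_apply]
    split_ifs
    · ring
    · simp

end VertexFun

theorem toLie_of (K : Type v) [CommRing K] {A : Type u} (a : A) : toLie K (.of a) = FreeLieAlgebra.of K a := by
  rw [toLie]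

theorem toLie_mul (K : Type v) [CommRing K] {A : Type u} (L M : FreeMagma A) : toLie K (L * M) = ⁅toLie K L, toLie K M⁆ := by
  rw [← FreeMagma.mul_eq, toLie]

/-! ### The recursive pairing as a homomorphism out of the free Lie algebra. -/

section Pairing
variable {A : Type u} {V : Type} [Fintype V] (adj : V → V → Prop) (lab : V → A)

open Classical in
/-- The configuration pairing of the full subgraph on a set of vertices with a Lie bracket
expression, computed recursively by cutting the graph. -/
noncomputable def subPairing : FreeMagma A → Finset V → ℤ
  | .of a, S => if ∃ v, S = {v} ∧ lab v = a then 1 else 0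
  | .mul H K, S => ∑ T : Finset V, ∑ U : Finset V,
      if T ∪ U = S then link adj T U * (subPairing H T * subPairing K U) else 0

open Classical in
theorem subPairing_of (a : A) (S : Finset V) :
    subPairing adj lab (.of a) S = if ∃ v, S = {v} ∧ lab v = a then 1 else 0 := by
  rw [subPairing]

open Classical in
theorem subPairing_mul (H K : FreeMagma A) (S : Finset V) :
    subPairing adj lab (H * K) S = ∑ T : Finset V, ∑ U : Finset V,
      if T ∪ U = S then link adj T U * (subPairing adj lab H T * subPairing adj lab K U)
      else 0 := by
  rw [← FreeMagma.mul_eq, subPairing]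

variable (K : Type v) [Field K] [CharZero K]

/-- The configuration pairings with the full subgraphs of a graph, on the free Lie algebra. -/
noncomputable def pairingHom : FreeLieAlgebra K A →ₗ⁅K⁆ VertexFun adj K :=
  FreeLieAlgebra.lift K fun a => fun S => (subPairing adj lab (.of a) S : K)

/-- The recursion for `subPairing` is literally the bracket of `VertexFun`. Hence the pairing
depends only on the Lie element that an expression represents. -/
theorem pairingHom_toLie (L : FreeMagma A) (S : Finset V) :
    pairingHom adj lab K (toLie K L) S = (subPairing adj lab L S : K) := by
  classical
  induction L generalizing S with
  | ih1 a =>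
    rw [toLie_of]
    exact congrFun (FreeLieAlgebra.lift_of_apply (L := VertexFun adj K) _ a) S
  | ih2 L M hL hM =>
    rw [toLie_mul, LieHom.map_lie, VertexFun.lie_apply, subPairing_mul]
    push_cast
    simp only [hL, hM]

end Pairing

/-! ### Unfolding the recursion into a sum over placements. -/

section Weight
variable {A : Type u} {V : Type}

open Classical in
/-- The vertices placed at the positions of a Lie bracket expression. -/
noncomputable def placed : (L : FreeMagma A) → (Pos L → V) → Finset V
  | .of _, τ => {τ ()}
  | .mul H K, τ => placed H (fun p => τ (.inl p)) ∪ placed K (fun p => τ (.inr p))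

open Classical in
theorem coe_placed : ∀ (L : FreeMagma A) (τ : Pos L → V), (placed L τ : Set V) = Set.range τ
  | .of _, τ => by
    rw [placed, Finset.coe_singleton]
    ext x
    exact ⟨fun h => ⟨(), h.symm⟩, fun ⟨_, h⟩ => h.symm⟩
  | .mul H K, τ => by
    rw [placed, Finset.coe_union, coe_placed H, coe_placed K]
    ext x
    simp

variable (adj : V → V → Prop) (lab : V → A)

open Classical in
/-- The contribution of a placement of vertices to the configuration pairing, computed
recursively. -/
noncomputable def weight : (L : FreeMagma A) → (Pos L → V) → ℤ
  | .of a, τ => if lab (τ ()) = a then 1 else 0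
  | .mul H K, τ =>
    link adj (placed H fun p => τ (.inl p)) (placed K fun p => τ (.inr p)) *
      (weight H (fun p => τ (.inl p)) * weight K (fun p => τ (.inr p)))

open Classical in
-- A placement in `[H, K]` is a pair of placements, and their images determine the cut `(T, U)`; so
-- the product of the two inductive sums, taken over all cuts, counts each pair once.
theorem subPairing_eq_finsum [Fintype V] : ∀ (L : FreeMagma A) (S : Finset V),
    subPairing adj lab L S =
      ∑ᶠ τ : Pos L → V, if placed L τ = S then weight adj lab L τ else 0
  | .of a, S => by
    rw [subPairing_of, ← finsum_comp_equiv (Equiv.funUnique Unit V).symm,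
      finsum_eq_sum_of_fintype]
    simp only [placed, weight, Equiv.funUnique_symm_apply, uniqueElim_const]
    split_ifs with h
    · obtain ⟨v, rfl, hv⟩ := h
      rw [Finset.sum_eq_single v]
      · simp [hv]
      · intro w _ hw
        simp [hw]
      · simp
    · symm
      refine Finset.sum_eq_zero fun v _ => ?_
      split_ifs with h1 h2
      · exact absurd ⟨v, h1.symm, h2⟩ h
      · rfl
      · rfl
  | .mul H K, S => by
    have := Pos.finite H
    have := Pos.finite K
    have := Fintype.ofFinite (Pos H → V)
    have := Fintype.ofFinite (Pos K → V)
    rw [FreeMagma.mul_eq, subPairing_mul,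
      ← finsum_comp_equiv (Equiv.sumArrowEquivProdArrow (Pos H) (Pos K) V).symm,
      finsum_eq_sum_of_fintype, Fintype.sum_prod_type]
    have h1 : ∀ T U : Finset V,
        (if T ∪ U = S then
          link adj T U * (subPairing adj lab H T * subPairing adj lab K U) else 0) =
        ∑ σ : Pos H → V, ∑ τ : Pos K → V, if placed H σ = T then if placed K τ = U then
          (if T ∪ U = S then link adj T U * (weight adj lab H σ * weight adj lab K τ) else 0)
          else 0 else 0 := by
      intro T U
      rw [subPairing_eq_finsum H, subPairing_eq_finsum K, finsum_eq_sum_of_fintype,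
        finsum_eq_sum_of_fintype, Finset.sum_mul_sum, Finset.mul_sum]
      split_ifs with hS
      · refine Finset.sum_congr rfl fun σ _ => ?_
        rw [Finset.mul_sum]
        refine Finset.sum_congr rfl fun τ _ => ?_
        split_ifs <;> simp
      · simp
    simp only [h1]
    rw [Finset.sum_congr rfl fun T _ => Finset.sum_comm, Finset.sum_comm]
    refine Finset.sum_congr rfl fun σ _ => ?_
    rw [Finset.sum_congr rfl fun T _ => Finset.sum_comm, Finset.sum_comm]
    refine Finset.sum_congr rfl fun τ _ => ?_
    rw [Finset.sum_eq_single (placed H σ) (fun T _ hT => by simp [hT.symm]) (by simp),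
      Finset.sum_eq_single (placed K τ) (fun T _ hT => by simp [hT.symm]) (by simp)]
    simp only [if_true]
    rfl

variable {adj lab}

/-- `link` vanishes on sets that meet, so a nonzero weight never puts one vertex at two positions.
-/
theorem weight_injective : ∀ (L : FreeMagma A) (τ : Pos L → V), weight adj lab L τ ≠ 0 →
    Function.Injective τ
  | .of _, τ, _ => fun _ _ _ => rfl
  | .mul H K, τ, h => by
    rw [weight] at h
    obtain ⟨h1, h2⟩ := mul_ne_zero_iff.1 h
    obtain ⟨h2, h3⟩ := mul_ne_zero_iff.1 h2
    have h4 : Disjoint (placed H fun p => τ (.inl p)) (placed K fun p => τ (.inr p)) := by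
      by_contra hc
      exact h1 (if_neg hc)
    rw [← Finset.disjoint_coe, coe_placed, coe_placed, Set.disjoint_range_iff] at h4
    have i1 := weight_injective H _ h2
    have i2 := weight_injective K _ h3
    rintro (p | p) (q | q) hpq
    · exact congrArg Sum.inl (i1 hpq)
    · exact absurd hpq (h4 p q)
    · exact absurd hpq.symm (h4 q p)
    · exact congrArg Sum.inr (i2 hpq)

theorem weight_label : ∀ (L : FreeMagma A) (τ : Pos L → V), weight adj lab L τ ≠ 0 →
    ∀ p, letterAt L p = lab (τ p)
  | .of a, τ, h, p => by
    rw [weight] at h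
    by_contra hc
    exact h (if_neg fun h => hc h.symm)
  | .mul H K, τ, h, p => by
    rw [weight] at h
    obtain ⟨h1, h2⟩ := mul_ne_zero_iff.1 h
    obtain ⟨h2, h3⟩ := mul_ne_zero_iff.1 h2
    rcases p with p | p
    · exact weight_label H _ h2 p
    · exact weight_label K _ h3 p

open Classical in
theorem arrows_eq_card (S T : Finset V) :
    arrows adj S T = ((S ×ˢ T).filter fun e => adj e.1 e.2).card := by
  rw [Finset.card_filter, Finset.sum_product]
  rfl

end Weight

/-! ### Comparison with the pairing defined by bijections. -/

section Good
variable {A : Type u} (G : LetterGraph A)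

theorem oneEdgeBetween_iff {S T : Finset G.V} (h : Disjoint S T) :
    OneEdgeBetween G S T ↔ arrows G.graph.Adj S T + arrows G.graph.Adj T S = 1 := by
  classical
  rw [arrows_eq_card, arrows_eq_card, ← Finset.card_union_of_disjoint, Finset.card_eq_one,
    Finset.singleton_iff_unique_mem]
  · unfold OneEdgeBetween
    refine existsUnique_congr fun e => ?_
    simp only [Finset.mem_coe, Finset.mem_union, Finset.mem_filter, Finset.mem_product]
    tauto
  · rw [Finset.disjoint_left]
    intro e he he'
    simp only [Finset.mem_filter, Finset.mem_product] at he he'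
    exact Finset.disjoint_left.1 h he.1.1 he'.1.1

/-- All sub-brackets cut the graph along exactly one edge into connected parts. -/
def IsGoodPlacement (L : FreeMagma A) (τ : Pos L → G.V) : Prop :=
  ∀ S T, IsSubBracket L S T →
    ConnectedOn G (τ '' S) ∧ ConnectedOn G (τ '' T) ∧ OneEdgeBetween G (τ '' S) (τ '' T)

variable {G}

theorem isGoodPlacement_mul {H K : FreeMagma A} {τ : Pos (.mul H K) → G.V} :
    IsGoodPlacement G (.mul H K) τ ↔
      (ConnectedOn G (Set.range fun p => τ (.inl p)) ∧
        ConnectedOn G (Set.range fun p => τ (.inr p)) ∧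
        OneEdgeBetween G (Set.range fun p => τ (.inl p)) (Set.range fun p => τ (.inr p))) ∧
      IsGoodPlacement G H (fun p => τ (.inl p)) ∧ IsGoodPlacement G K (fun p => τ (.inr p)) := by
  constructor
  · intro h
    refine ⟨?_, fun S T hST => ?_, fun S T hST => ?_⟩
    · have := h _ _ (Or.inl ⟨rfl, rfl⟩)
      rwa [← Set.range_comp, ← Set.range_comp] at this
    · have := h _ _ (Or.inr (Or.inl ⟨S, T, hST, rfl, rfl⟩))
      rwa [Set.image_image, Set.image_image] at this
    · have := h _ _ (Or.inr (Or.inr ⟨S, T, hST, rfl, rfl⟩))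
      rwa [Set.image_image, Set.image_image] at this
  · rintro ⟨h1, h2, h3⟩ S T (⟨rfl, rfl⟩ | ⟨S', T', h, rfl, rfl⟩ | ⟨S', T', h, rfl, rfl⟩)
    · rw [← Set.range_comp, ← Set.range_comp]
      exact h1
    · rw [Set.image_image, Set.image_image]
      exact h2 _ _ h
    · rw [Set.image_image, Set.image_image]
      exact h3 _ _ h

theorem ConnectedOn.union {S T : Set G.V} (hS : ConnectedOn G S) (hT : ConnectedOn G T)
    (h : Disjoint S T) (h1 : OneEdgeBetween G S T) : ConnectedOn G (S ∪ T) := by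
  obtain ⟨e, ⟨he, he'⟩, -⟩ := h1
  unfold ConnectedOn at *
  rcases he' with ⟨h1, h2⟩ | ⟨h1, h2⟩
  · refine SimpleGraph.connected_induce_union hS.preconnected hT.preconnected h1 h2 ?_
    exact ⟨fun hc => Set.disjoint_left.1 h h1 (hc ▸ h2), Or.inl he⟩
  · refine SimpleGraph.connected_induce_union hS.preconnected hT.preconnected h2 h1 ?_
    exact ⟨fun hc => Set.disjoint_left.1 h h2 (hc ▸ h1), Or.inr he⟩

/-- Each sub-bracket joins two connected parts by an edge, so connectedness propagates from the
letters upwards. -/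
theorem IsGoodPlacement.connectedOn_range : ∀ {L : FreeMagma A} {τ : Pos L → G.V},
    Function.Injective τ → IsGoodPlacement G L τ → ConnectedOn G (Set.range τ)
  | .of _, τ, _, _ => by
    have : Set.range τ = {τ ()} := by
      ext x
      exact ⟨fun ⟨_, h⟩ => h.symm, fun h => ⟨(), h.symm⟩⟩
    rw [this, ConnectedOn]
    exact SimpleGraph.Connected.of_subsingleton
  | .mul H K, τ, hτ, h => by
    obtain ⟨⟨h1, h2, h3⟩, -, -⟩ := isGoodPlacement_mul.1 h
    have := h1.union h2 (by
      rw [Set.disjoint_range_iff]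
      intro p q hpq
      simpa using hτ hpq) h3
    have e : Set.range τ = (Set.range fun p => τ (.inl p)) ∪ Set.range fun p => τ (.inr p) := by
      ext x
      simp
    rwa [e]

/-- The weight tests only that there is one edge at each cut. Connectedness of the two parts is
automatic, since the smaller sub-brackets are already good. -/
theorem isGoodPlacement_iff : ∀ {L : FreeMagma A} {τ : Pos L → G.V}, Function.Injective τ →
    (∀ p, letterAt L p = G.label (τ p)) →
    (IsGoodPlacement G L τ ↔ weight G.graph.Adj G.label L τ ≠ 0)
  | .of a, τ, _, hl => by
    have ha : G.label (τ ()) = a := (hl ()).symm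
    rw [weight, if_pos ha]
    exact ⟨fun _ => one_ne_zero, fun _ _ _ h => h.elim⟩
  | .mul H K, τ, hτ, hl => by
    have i1 : Function.Injective fun p => τ (.inl p) := hτ.comp Sum.inl_injective
    have i2 : Function.Injective fun p => τ (.inr p) := hτ.comp Sum.inr_injective
    have hd : Disjoint (placed H fun p => τ (.inl p)) (placed K fun p => τ (.inr p)) := by
      rw [← Finset.disjoint_coe, coe_placed, coe_placed, Set.disjoint_range_iff]
      intro p q hpq
      simpa using hτ hpq
    rw [isGoodPlacement_mul, weight, mul_ne_zero_iff, mul_ne_zero_iff,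
      ← isGoodPlacement_iff i1 fun p => hl (.inl p),
      ← isGoodPlacement_iff i2 fun p => hl (.inr p), ← coe_placed, ← coe_placed,
      oneEdgeBetween_iff G hd]
    have hlink : link G.graph.Adj (placed H fun p => τ (.inl p)) (placed K fun p => τ (.inr p)) ≠ 0
        ↔ arrows G.graph.Adj (placed H fun p => τ (.inl p)) (placed K fun p => τ (.inr p)) +
          arrows G.graph.Adj (placed K fun p => τ (.inr p)) (placed H fun p => τ (.inl p)) = 1 := by
      rw [link, if_pos hd, linkSign]
      split_ifs <;> omega
    rw [hlink]
    constructor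
    · rintro ⟨⟨-, -, h1⟩, h2⟩
      exact ⟨h1, h2⟩
    · rintro ⟨h1, h2⟩
      refine ⟨⟨?_, ?_, h1⟩, h2⟩
      · rw [coe_placed]
        exact h2.1.connectedOn_range i1
      · rw [coe_placed]
        exact h2.2.connectedOn_range i2

/-- The pairs of positions which are joined by an edge that moves leftwards. -/
def leftwardPairs (L : FreeMagma A) (τ : Pos L → G.V) : Set (Pos L × Pos L) :=
  {e | G.graph.Adj (τ e.1) (τ e.2) ∧ LeftOf L e.2 e.1}

/-- A leftward edge lies inside `H`, lies inside `K`, or runs from `K` to `H`; only the last kind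
concerns the outermost bracket. -/
theorem ncard_leftwardPairs_mul {H K : FreeMagma A} {τ : Pos (.mul H K) → G.V}
    (hτ : Function.Injective τ) :
    (leftwardPairs (.mul H K) τ).ncard =
      (leftwardPairs H fun p => τ (.inl p)).ncard + (leftwardPairs K fun p => τ (.inr p)).ncard +
      arrows G.graph.Adj (placed K fun p => τ (.inr p)) (placed H fun p => τ (.inl p)) := by
  classical
  have := Pos.finite H
  have := Pos.finite K
  have e : leftwardPairs (.mul H K) τ =
      (Prod.map Sum.inl Sum.inl '' (leftwardPairs H fun p => τ (.inl p)) ∪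
        Prod.map Sum.inr Sum.inr '' (leftwardPairs K fun p => τ (.inr p))) ∪
      Prod.map Sum.inr Sum.inl ''
        {e : Pos K × Pos H | G.graph.Adj (τ (.inr e.1)) (τ (.inl e.2))} := by
    ext ⟨p | p, q | q⟩ <;> simp [leftwardPairs, LeftOf]
  have hfin : ∀ s : Set (Pos (.mul H K) × Pos (.mul H K)), s.Finite := fun s => by
    have := Pos.finite (.mul H K)
    exact Set.toFinite s
  rw [e, Set.ncard_union_eq ?_ (hfin _) (hfin _), Set.ncard_union_eq ?_ (hfin _) (hfin _),
    Set.ncard_image_of_injective _ (Sum.inl_injective.prodMap Sum.inl_injective),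
    Set.ncard_image_of_injective _ (Sum.inr_injective.prodMap Sum.inr_injective),
    Set.ncard_image_of_injective _ (Sum.inr_injective.prodMap Sum.inl_injective)]
  · congr 1
    rw [arrows_eq_card, ← Set.ncard_coe_finset,
      ← Set.ncard_image_of_injective (f := Prod.map (fun p => τ (.inr p)) fun p => τ (.inl p)) _
      ((hτ.comp Sum.inr_injective).prodMap (hτ.comp Sum.inl_injective))]
    congr 1
    ext ⟨x, y⟩
    have h1 : ∀ x, x ∈ placed K (fun p => τ (.inr p)) ↔ ∃ p, τ (.inr p) = x := fun x => by
      rw [← Finset.mem_coe, coe_placed, Set.mem_range]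
    have h2 : ∀ x, x ∈ placed H (fun p => τ (.inl p)) ↔ ∃ p, τ (.inl p) = x := fun x => by
      rw [← Finset.mem_coe, coe_placed, Set.mem_range]
    simp only [Finset.coe_filter, Finset.mem_product, h1, h2, Set.mem_image, Set.mem_ofPred_eq,
      Prod.exists, Prod.map_apply, Prod.mk.injEq]
    constructor
    · rintro ⟨p, q, h, rfl, rfl⟩
      exact ⟨⟨⟨p, rfl⟩, ⟨q, rfl⟩⟩, h⟩
    · rintro ⟨⟨⟨p, rfl⟩, ⟨q, rfl⟩⟩, h⟩
      exact ⟨p, q, h, rfl, rfl⟩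
  · rw [Set.disjoint_left]
    rintro _ ⟨⟨p, q⟩, -, rfl⟩ ⟨⟨p', q'⟩, -, h⟩
    simp at h
  · rw [Set.disjoint_left]
    rintro _ (⟨⟨p, q⟩, -, rfl⟩ | ⟨⟨p, q⟩, -, rfl⟩) ⟨⟨p', q'⟩, -, h⟩ <;> simp at h

/-- The single edge across a cut has link `1` if it points from `H` to `K` and `-1` otherwise, that
is `(-1)` to the number of arrows from `K` to `H`. -/
theorem weight_eq_sign : ∀ {L : FreeMagma A} {τ : Pos L → G.V},
    weight G.graph.Adj G.label L τ ≠ 0 →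
    weight G.graph.Adj G.label L τ = (-1) ^ (leftwardPairs L τ).ncard
  | .of a, τ, h => by
    have e : leftwardPairs (.of a) τ = ∅ := by
      ext
      simp [leftwardPairs, LeftOf]
    rw [e, Set.ncard_empty, pow_zero, weight]
    rw [weight] at h
    by_contra hc
    simp_all
  | .mul H K, τ, h => by
    rw [ncard_leftwardPairs_mul (weight_injective _ _ h), pow_add, pow_add]
    rw [weight] at h ⊢
    obtain ⟨h1, h2⟩ := mul_ne_zero_iff.1 h
    obtain ⟨h2, h3⟩ := mul_ne_zero_iff.1 h2
    rw [weight_eq_sign h2, weight_eq_sign h3, mul_comm]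
    congr 1
    rw [link] at h1 ⊢
    split_ifs at h1 ⊢
    · rw [linkSign] at h1 ⊢
      split_ifs at h1 ⊢ with h4
      · generalize arrows G.graph.Adj _ _ = a at *
        generalize arrows G.graph.Adj _ _ = b at *
        obtain ⟨rfl, rfl⟩ | ⟨rfl, rfl⟩ : a = 1 ∧ b = 0 ∨ a = 0 ∧ b = 1 := by omega
        · simp
        · simp
      · exact absurd rfl h1
    · exact absurd rfl h1

theorem pairingAt_eq_weight (L : FreeMagma A) (σ : Bij G L) :
    pairingAt G L σ = weight G.graph.Adj G.label L σ.1.symm := by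
  have hl : ∀ p, letterAt L p = G.label (σ.1.symm p) := fun p => by
    rw [← σ.2, Equiv.apply_symm_apply]
  have h := isGoodPlacement_iff σ.1.symm.injective hl
  unfold pairingAt
  have hi : ∀ S : Set (Pos L), σ.1 ⁻¹' S = σ.1.symm '' S := fun S =>
    (Equiv.image_symm_eq_preimage σ.1 S).symm
  split_ifs with h1
  · obtain ⟨S, T, hST, h1⟩ := h1
    by_contra hc
    rw [hi, hi] at h1
    exact h1 (h.2 (Ne.symm hc) S T hST)
  · have h2 : weight G.graph.Adj G.label L σ.1.symm ≠ 0 := by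
      rw [← h]
      intro S T hST
      by_contra hc
      exact h1 ⟨S, T, hST, by rwa [hi, hi]⟩
    rw [weight_eq_sign h2, leftwardEdges]
    congr 1
    rw [← Set.ncard_image_of_injective (f := Prod.map σ.1 σ.1) _
      (σ.1.injective.prodMap σ.1.injective)]
    congr 1
    ext ⟨p, q⟩
    simp only [leftwardPairs, Set.mem_image, Set.mem_ofPred_eq, Prod.exists, Prod.map_apply,
      Prod.mk.injEq]
    constructor
    · rintro ⟨x, y, h, rfl, rfl⟩
      simpa using h
    · intro h
      exact ⟨σ.1.symm p, σ.1.symm q, by simpa using h, by simp, by simp⟩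

theorem pairing_eq_subPairing [Fintype G.V] (L : FreeMagma A) :
    pairing G L = subPairing G.graph.Adj G.label L Finset.univ := by
  classical
  have := Pos.finite L
  have := Fintype.ofFinite (Pos L → G.V)
  have := Fintype.ofFinite (Bij G L)
  rw [subPairing_eq_finsum, pairing, finsum_eq_sum_of_fintype, finsum_eq_sum_of_fintype]
  -- Bijections are sent to their inverses, which are placements. A placement outside the image
  -- contributes zero: onto all vertices and of nonzero weight, it would be injective and
  -- label-preserving.
  refine Fintype.sum_of_injective (fun σ : Bij G L => (σ.1.symm : Pos L → G.V)) ?_ _ _ ?_ ?_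
  · intro σ τ h
    exact Subtype.ext (Equiv.symm_bijective.injective (DFunLike.coe_injective h))
  · intro τ hτ
    split_ifs with h
    · by_contra hw
      refine hτ ?_
      have hs : Function.Surjective τ := by
        rw [← Set.range_eq_univ, ← coe_placed, h, Finset.coe_univ]
      refine ⟨⟨(Equiv.ofBijective τ ⟨weight_injective _ _ hw, hs⟩).symm, fun x => ?_⟩, rfl⟩
      rw [weight_label _ _ hw]
      congr 1
      exact Equiv.apply_symm_apply (Equiv.ofBijective τ _) x
    · rfl
  · intro σ
    rw [if_pos, pairingAt_eq_weight]
    rw [← Finset.coe_inj, coe_placed, Finset.coe_univ, Set.range_eq_univ]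
    exact σ.1.symm.surjective

end Good
-- What a nonzero pairing forces on a vertex set.
section Cut
variable {A : Type u} {V : Type} {adj : V → V → Prop} {lab : V → A}

theorem disjoint_of_link_ne_zero {S T : Finset V} (h : link adj S T ≠ 0) : Disjoint S T := by
  by_contra hc
  exact h (if_neg hc)

theorem exists_adj_of_link_ne_zero {S T : Finset V} (h : link adj S T ≠ 0) :
    ∃ x ∈ S, ∃ y ∈ T, adj x y ∨ adj y x := by
  by_contra! hc
  have h1 : arrows adj S T = 0 := (arrows_eq_zero_iff adj).2 fun x hx y hy => (hc x hx y hy).1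
  have h2 : arrows adj T S = 0 := (arrows_eq_zero_iff adj).2 fun x hx y hy => (hc y hy x hx).2
  rw [link, h1, h2] at h
  simp [linkSign] at h

variable [Fintype V]

open Classical in
theorem exists_cut {H K : FreeMagma A} {S : Finset V} (h : subPairing adj lab (H * K) S ≠ 0) :
    ∃ T U, T ∪ U = S ∧ link adj T U ≠ 0 ∧ subPairing adj lab H T ≠ 0 ∧
      subPairing adj lab K U ≠ 0 := by
  rw [subPairing_mul] at h
  obtain ⟨T, -, h⟩ := Finset.exists_ne_zero_of_sum_ne_zero h
  obtain ⟨U, -, h⟩ := Finset.exists_ne_zero_of_sum_ne_zero h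
  have h1 : T ∪ U = S := by
    by_contra hc
    exact h (if_neg hc)
  rw [if_pos h1, mul_ne_zero_iff, mul_ne_zero_iff] at h
  exact ⟨T, U, h1, h⟩

theorem exists_of_subPairing_of_ne_zero {a : A} {S : Finset V}
    (h : subPairing adj lab (.of a) S ≠ 0) : ∃ v, S = {v} ∧ lab v = a := by
  classical
  rw [subPairing_of] at h
  by_contra hc
  exact h (if_neg hc)

/-- The letters of a Lie bracket expression, with multiplicities. -/
def letters : FreeMagma A → Multiset A
  | .of a => {a}
  | .mul H K => letters H + letters K

theorem letters_of (a : A) : letters (.of a) = {a} := by rw [letters]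

theorem letters_mul (H K : FreeMagma A) : letters (H * K) = letters H + letters K := by
  rw [← FreeMagma.mul_eq, letters]

theorem sum_label_eq_letters {L : FreeMagma A} {S : Finset V}
    (h : subPairing adj lab L S ≠ 0) : ∑ x ∈ S, ({lab x} : Multiset A) = letters L := by
  classical
  induction L generalizing S with
  | ih1 a =>
    obtain ⟨v, rfl, rfl⟩ := exists_of_subPairing_of_ne_zero h
    rw [Finset.sum_singleton, letters_of]
  | ih2 H K hH hK =>
    obtain ⟨T, U, rfl, h1, h2, h3⟩ := exists_cut h
    rw [Finset.sum_union (disjoint_of_link_ne_zero h1), hH h2, hK h3, letters_mul]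

/-- Only the absence of isolated vertices is needed later: it will tie a leaf to its anchor. -/
theorem exists_adj_of_subPairing_ne_zero {L : FreeMagma A} {S : Finset V}
    (h : subPairing adj lab L S ≠ 0) {x : V} (hx : x ∈ S) (hS : S ≠ {x}) :
    ∃ y ∈ S, adj x y ∨ adj y x := by
  classical
  induction L generalizing S with
  | ih1 a =>
    obtain ⟨v, rfl, rfl⟩ := exists_of_subPairing_of_ne_zero h
    exact absurd (by rw [Finset.mem_singleton.1 hx]) hS
  | ih2 H K hH hK =>
    obtain ⟨T, U, rfl, h1, h2, h3⟩ := exists_cut h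
    obtain ⟨y, hy, z, hz, hyz⟩ := exists_adj_of_link_ne_zero h1
    rcases Finset.mem_union.1 hx with hxT | hxU
    · by_cases hT : T = {x}
      · subst hT
        rw [Finset.mem_singleton.1 hy] at hyz
        exact ⟨z, Finset.mem_union_right _ hz, hyz⟩
      · obtain ⟨w, hw, h⟩ := hH h2 hxT hT
        exact ⟨w, Finset.mem_union_left _ hw, h⟩
    · by_cases hU : U = {x}
      · subst hU
        rw [Finset.mem_singleton.1 hz] at hyz
        exact ⟨y, Finset.mem_union_left _ hy, hyz.symm⟩
      · obtain ⟨w, hw, h⟩ := hK h3 hxU hU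
        exact ⟨w, Finset.mem_union_right _ hw, h⟩

open Classical in
-- The part matched with a single letter is a singleton `{x}`, and disjointness then makes the other
-- part `S.erase x`.
theorem subPairing_of_mul (a : A) (L : FreeMagma A) (S : Finset V) :
    subPairing adj lab (.of a * L) S = ∑ x ∈ S, if lab x = a then
      link adj {x} (S.erase x) * subPairing adj lab L (S.erase x) else 0 := by
  rw [subPairing_mul, ← Finset.sum_subset (Finset.subset_univ (S.image fun x => {x})),
    Finset.sum_image (fun x _ y _ h => Finset.singleton_injective h)]
  · refine Finset.sum_congr rfl fun x hx => ?_
    rw [Finset.sum_eq_single (S.erase x)]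
    · rw [if_pos (by rw [← Finset.insert_eq, Finset.insert_erase hx]), subPairing_of]
      by_cases hl : lab x = a
      · rw [if_pos hl, if_pos ⟨x, rfl, hl⟩, one_mul]
      · rw [if_neg hl, if_neg, zero_mul, mul_zero]
        rintro ⟨v, h1, h2⟩
        rw [Finset.singleton_inj.1 h1] at hl
        exact hl h2
    · intro U _ hU
      split_ifs with h
      · have : ¬ Disjoint {x} U := by
          intro hd
          refine hU ?_
          rw [← h, ← Finset.insert_eq, Finset.erase_insert]
          exact Finset.disjoint_singleton_left.1 hd
        rw [link, if_neg this, zero_mul]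
      · rfl
    · simp
  · intro T _ hT
    refine Finset.sum_eq_zero fun U _ => ?_
    split_ifs with h
    · by_cases h1 : subPairing adj lab (.of a) T = 0
      · rw [h1, zero_mul, mul_zero]
      · obtain ⟨v, rfl, -⟩ := exists_of_subPairing_of_ne_zero h1
        refine absurd (Finset.mem_image.2 ⟨v, ?_, rfl⟩) hT
        rw [← h]
        simp
    · rfl

end Cut

/-! ### Blowing up vertices into stars. -/

/-- Replacing every letter `b` by the left-greedy bracketing of `αⁿχ`, where `n` and `χ` depend
on `b`. -/
def simpleBracket {A : Type u} {B : Type u} (α : A) (mult : B → ℕ) (letter : B → A) (b : B) :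
    FreeMagma A :=
  (fun e => FreeMagma.of α * e)^[mult b] (.of (letter b))

/-- The first graph is obtained from the second one by replacing each vertex labelled `b` by a
vertex `χ` to which `n` leaves `α` are attached, where `n` and `χ` depend on `b`. The map `π`
contracts the leaves, and `ι` is its section. -/
structure IsBlowUp {A B : Type u} {V W : Type} (adj : V → V → Prop) (lab : V → A)
    (adj' : W → W → Prop) (lab' : W → B) (α : A) (mult : B → ℕ) (letter : B → A)
    (π : V → W) (ι : W → V) : Prop where
  proj_anchor : ∀ v, π (ι v) = v
  adj_iff : ∀ x y, adj x y ↔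
    (x = ι (π x) ∧ y = ι (π y) ∧ adj' (π x) (π y)) ∨
    (π x = π y ∧ x ≠ ι (π x) ∧ y = ι (π y))
  label_anchor : ∀ v, lab (ι v) = letter (lab' v)
  label_leaf : ∀ x, x ≠ ι (π x) → lab x = α
  card_leaves : ∀ v, {x | π x = v ∧ x ≠ ι v}.ncard = mult (lab' v)

section BlowUp
variable {A B : Type u} {V W : Type} {adj : V → V → Prop} {lab : V → A}
  {adj' : W → W → Prop} {lab' : W → B} {α : A} {mult : B → ℕ} {letter : B → A}
  {π : V → W} {ι : W → V}

namespace IsBlowUp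

theorem anchor_injective (D : IsBlowUp adj lab adj' lab' α mult letter π ι) :
    Function.Injective ι := fun v w h => by
  rw [← D.proj_anchor v, h, D.proj_anchor]

theorem not_adj_leaf (D : IsBlowUp adj lab adj' lab' α mult letter π ι)
    {x y : V} (hx : x ≠ ι (π x)) :
    ¬ adj y x := by
  rw [D.adj_iff]
  rintro (⟨-, h, -⟩ | ⟨-, -, h⟩) <;> exact hx h

theorem leaf_adj_iff (D : IsBlowUp adj lab adj' lab' α mult letter π ι)
    {x y : V} (hx : x ≠ ι (π x)) :
    adj x y ↔ y = ι (π x) := by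
  rw [D.adj_iff]
  constructor
  · rintro (⟨h, -⟩ | ⟨h, -, h'⟩)
    · exact absurd h hx
    · rw [h', h]
  · rintro rfl
    refine Or.inr ⟨?_, hx, ?_⟩ <;> rw [D.proj_anchor]

end IsBlowUp

variable [Fintype V]

theorem exists_of_subPairing_iterate_ne_zero {a : A} (k : ℕ) {S : Finset V}
    (h : subPairing adj lab ((fun e => FreeMagma.of α * e)^[k] (.of a)) S ≠ 0) :
    ∃ y ∈ S, lab y = a ∧ ∀ x ∈ S, x ≠ y → lab x = α := by
  classical
  induction k generalizing S with
  | zero =>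
    obtain ⟨v, rfl, hv⟩ := exists_of_subPairing_of_ne_zero h
    exact ⟨v, by simp, hv, by simp⟩
  | succ k ih =>
    rw [Function.iterate_succ_apply'] at h
    obtain ⟨T, U, rfl, h1, h2, h3⟩ := exists_cut h
    obtain ⟨v, rfl, hv⟩ := exists_of_subPairing_of_ne_zero h2
    obtain ⟨y, hy, hya, h4⟩ := ih h3
    refine ⟨y, Finset.mem_union_right _ hy, hya, fun x hx hxy => ?_⟩
    rcases Finset.mem_union.1 hx with hx | hx
    · rw [Finset.mem_singleton.1 hx, hv]
    · exact h4 x hx hxy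

theorem exists_label_ne (hα : ∀ b, letter b ≠ α) {L : FreeMagma B} {S : Finset V}
    (h : subPairing adj lab (FreeMagma.lift (simpleBracket α mult letter) L) S ≠ 0) :
    ∃ x ∈ S, lab x ≠ α := by
  classical
  induction L generalizing S with
  | ih1 b =>
    obtain ⟨y, hy, hy', -⟩ := exists_of_subPairing_iterate_ne_zero _ h
    exact ⟨y, hy, hy' ▸ hα b⟩
  | ih2 H K hH hK =>
    rw [map_mul] at h
    obtain ⟨T, U, rfl, h1, h2, h3⟩ := exists_cut h
    obtain ⟨x, hx, h⟩ := hH h2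
    exact ⟨x, Finset.mem_union_left _ hx, h⟩

namespace IsBlowUp
-- Every substituted block contains a letter other than `α`, so `S` is not a lone leaf. A leaf in
-- `S` therefore has a neighbour in `S`, and its anchor is the only candidate.
theorem anchor_mem (D : IsBlowUp adj lab adj' lab' α mult letter π ι)
    (hα : ∀ b, letter b ≠ α) {L : FreeMagma B} {S : Finset V}
    (h : subPairing adj lab (FreeMagma.lift (simpleBracket α mult letter) L) S ≠ 0)
    {x : V} (hx : x ∈ S) : ι (π x) ∈ S := by
  by_cases hleaf : x = ι (π x)
  · rwa [← hleaf]
  · have hS : S ≠ {x} := by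
      rintro rfl
      obtain ⟨y, hy, h'⟩ := exists_label_ne hα h
      rw [Finset.mem_singleton.1 hy] at h'
      exact h' (D.label_leaf x hleaf)
    obtain ⟨y, hy, h1 | h1⟩ := exists_adj_of_subPairing_ne_zero h hx hS
    · rwa [← (D.leaf_adj_iff hleaf).1 h1]
    · exact absurd h1 (D.not_adj_leaf hleaf)

open Classical in
-- The outermost `α` can be matched with any of the leaves, each joined to the centre by an edge
-- pointing right, hence of sign `+1`. Peeling off the leaves one by one gives the factorial.
theorem subPairing_star (D : IsBlowUp adj lab adj' lab' α mult letter π ι)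
    (hα : ∀ b, letter b ≠ α) (v : W) (k : ℕ) (F : Finset V) (hF : ∀ x ∈ F, π x = v ∧ x ≠ ι v) :
    subPairing adj lab ((fun e => FreeMagma.of α * e)^[k] (.of (letter (lab' v))))
      (insert (ι v) F) = if F.card = k then (k.factorial : ℤ) else 0 := by
  have hv : ι v ∉ F := fun h => (hF _ h).2 rfl
  induction k generalizing F with
  | zero =>
    rw [Function.iterate_zero, id, subPairing_of]
    by_cases h : F.card = 0
    · obtain rfl := Finset.card_eq_zero.1 h
      rw [if_pos ⟨ι v, by simp, D.label_anchor v⟩]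
      simp
    · rw [if_neg h, if_neg]
      rintro ⟨w, h1, -⟩
      have h2 := congrArg Finset.card h1
      rw [Finset.card_insert_of_notMem hv, Finset.card_singleton] at h2
      omega
  | succ k ih =>
    -- The anchor itself cannot be peeled off: its label is not `α`.
    rw [Function.iterate_succ_apply', subPairing_of_mul, Finset.sum_insert hv, if_neg, zero_add]
    · have h1 : ∀ x ∈ F, (if lab x = α then link adj {x} ((insert (ι v) F).erase x) *
          subPairing adj lab ((fun e => FreeMagma.of α * e)^[k] (.of (letter (lab' v))))
            ((insert (ι v) F).erase x) else 0) =
          if F.card = k + 1 then (k.factorial : ℤ) else 0 := by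
        intro x hx
        obtain ⟨hπ, hxv⟩ := hF x hx
        have hleaf : x ≠ ι (π x) := hπ ▸ hxv
        rw [if_pos (D.label_leaf x hleaf), Finset.erase_insert_of_ne hxv.symm,
          ih (F.erase x) (fun y hy => hF y (Finset.mem_of_mem_erase hy))
            (fun h => hv (Finset.mem_of_mem_erase h)),
          Finset.card_erase_of_mem hx]
        have hd : Disjoint {x} (insert (ι v) (F.erase x)) := by
          simp [hxv]
        have a1 : arrows adj {x} (insert (ι v) (F.erase x)) = 1 := by
          rw [arrows, Finset.sum_singleton, Finset.sum_eq_single (ι v)]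
          · rw [if_pos]
            rw [D.leaf_adj_iff hleaf, hπ]
          · intro y _ hy
            rw [if_neg]
            rwa [D.leaf_adj_iff hleaf, hπ]
          · simp
        have a2 : arrows adj (insert (ι v) (F.erase x)) {x} = 0 := by
          rw [arrows_eq_zero_iff]
          intro y _ z hz
          rw [Finset.mem_singleton.1 hz]
          exact D.not_adj_leaf hleaf
        have hpos : 0 < F.card := Finset.card_pos.2 ⟨x, hx⟩
        rw [link, if_pos hd, a1, a2]
        have : F.card - 1 = k ↔ F.card = k + 1 := by omega
        simp [linkSign, this]
      rw [Finset.sum_congr rfl h1, Finset.sum_const]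
      split_ifs with h
      · rw [h, Nat.factorial_succ]
        simp
      · simp
    · rw [D.label_anchor]
      exact hα _

open Classical in
/-- The vertices over a set of vertices. -/
noncomputable def fibers (π : V → W) (S : Finset W) : Finset V := {x | π x ∈ S}

theorem mem_fibers {S : Finset W} {x : V} : x ∈ fibers π S ↔ π x ∈ S := by
  simp [fibers]

theorem fibers_injective (D : IsBlowUp adj lab adj' lab' α mult letter π ι) :
    Function.Injective (fibers π) := by
  intro S T h
  ext v
  have := Finset.ext_iff.1 h (ι v)
  rwa [mem_fibers, mem_fibers, D.proj_anchor] at this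

open Classical in
theorem fibers_union (S T : Finset W) : fibers π (S ∪ T) = fibers π S ∪ fibers π T := by
  ext x
  simp [mem_fibers]

theorem disjoint_fibers_iff (D : IsBlowUp adj lab adj' lab' α mult letter π ι) {S T : Finset W} :
    Disjoint (fibers π S) (fibers π T) ↔ Disjoint S T := by
  simp only [Finset.disjoint_left, mem_fibers]
  refine ⟨fun h v hv => ?_, fun h x hx => h hx⟩
  have := @h (ι v)
  rw [D.proj_anchor] at this
  exact this hv

/-- Edges of leaves stay within one fibre, so only edges between anchors connect fibres over
disjoint sets. -/
theorem arrows_fibers (D : IsBlowUp adj lab adj' lab' α mult letter π ι) {S T : Finset W}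
    (h : Disjoint S T) : arrows adj (fibers π S) (fibers π T) = arrows adj' S T := by
  classical
  rw [arrows_eq_card, arrows_eq_card,
    ← Finset.card_image_of_injective _ (D.anchor_injective.prodMap D.anchor_injective)]
  congr 1
  ext ⟨x, y⟩
  simp only [Finset.mem_filter, Finset.mem_product, mem_fibers, Finset.mem_image, Prod.exists,
    Prod.map_apply, Prod.mk.injEq]
  constructor
  · rintro ⟨⟨h1, h2⟩, h3⟩
    rcases (D.adj_iff x y).1 h3 with ⟨h4, h5, h6⟩ | ⟨h4, -⟩
    · exact ⟨π x, π y, ⟨⟨h1, h2⟩, h6⟩, h4.symm, h5.symm⟩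
    · rw [← h4] at h2
      exact absurd h2 (Finset.disjoint_left.1 h h1)
  · rintro ⟨v, w, ⟨⟨h1, h2⟩, h3⟩, rfl, rfl⟩
    rw [D.adj_iff]
    simp only [D.proj_anchor]
    exact ⟨⟨h1, h2⟩, Or.inl ⟨trivial, trivial, h3⟩⟩

theorem link_fibers (D : IsBlowUp adj lab adj' lab' α mult letter π ι) (S T : Finset W) :
    link adj (fibers π S) (fibers π T) = link adj' S T := by
  classical
  by_cases h : Disjoint S T
  · rw [link, link, if_pos h, if_pos (D.disjoint_fibers_iff.2 h), D.arrows_fibers h,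
      D.arrows_fibers h.symm]
  · rw [link, link, if_neg h, if_neg fun h' => h (D.disjoint_fibers_iff.1 h')]

theorem subPairing_fibers_of [Fintype W] (D : IsBlowUp adj lab adj' lab' α mult letter π ι)
    (hα : ∀ b, letter b ≠ α) (hinj : ∀ b c, mult b = mult c → letter b = letter c → b = c)
    (b : B) (S : Finset W) :
    subPairing adj lab (simpleBracket α mult letter b) (fibers π S) =
      (∏ v ∈ S, ((mult (lab' v)).factorial : ℤ)) * subPairing adj' lab' (.of b) S := by
  classical
  have leaves : ∀ v, fibers π {v} = insert (ι v) ({x | π x = v ∧ x ≠ ι v} : Finset V) := by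
    intro v
    ext x
    simp only [mem_fibers, Finset.mem_singleton, Finset.mem_insert, Finset.mem_filter,
      Finset.mem_univ, true_and]
    constructor
    · intro h
      by_cases hx : x = ι v
      · exact Or.inl hx
      · exact Or.inr ⟨h, hx⟩
    · rintro (rfl | ⟨h, -⟩)
      · exact D.proj_anchor v
      · exact h
  have card : ∀ v, ({x | π x = v ∧ x ≠ ι v} : Finset V).card = mult (lab' v) := by
    intro v
    rw [← D.card_leaves v, ← Set.ncard_coe_finset]
    congr 1
    ext
    simp
  have star : ∀ v, letter b = letter (lab' v) →
      subPairing adj lab (simpleBracket α mult letter b) (fibers π {v}) =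
        if mult (lab' v) = mult b then ((mult b).factorial : ℤ) else 0 := by
    intro v h
    rw [leaves, simpleBracket, h, D.subPairing_star hα, card]
    simp
  by_cases hS : subPairing adj lab (simpleBracket α mult letter b) (fibers π S) = 0
  · rw [hS, eq_comm, mul_eq_zero]
    right
    by_contra hc
    obtain ⟨v, rfl, rfl⟩ := exists_of_subPairing_of_ne_zero hc
    rw [star v rfl, if_pos rfl] at hS
    exact Nat.factorial_ne_zero _ (by exact_mod_cast hS)
  · obtain ⟨y, hy, hy', h1⟩ := exists_of_subPairing_iterate_ne_zero _ hS
    have hya : y = ι (π y) := by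
      by_contra hc
      exact hα b (hy' ▸ D.label_leaf y hc)
    obtain ⟨v, rfl⟩ : ∃ v, y = ι v := ⟨_, hya⟩
    rw [D.label_anchor] at hy'
    -- Every fibre contains an anchor, whose label is not `α`, whereas one block has room for just
    -- one such label.
    have hSv : S = {v} := by
      ext w
      rw [Finset.mem_singleton]
      constructor
      · intro hw
        by_contra hc
        have := h1 (ι w) (by rwa [mem_fibers, D.proj_anchor]) (D.anchor_injective.ne hc)
        rw [D.label_anchor] at this
        exact hα _ this
      · rintro rfl
        rwa [mem_fibers, D.proj_anchor] at hy
    subst hSv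
    rw [star v hy'.symm] at hS ⊢
    have hm : mult (lab' v) = mult b := by
      by_contra hc
      exact hS (if_neg hc)
    have hb := hinj _ _ hm hy'
    rw [if_pos hm, Finset.prod_singleton, hm, subPairing_of, if_pos ⟨v, rfl, hb⟩, mul_one]

/-- The configuration pairing is compatible with blowing up the graph and the Lie bracket
expression. -/
theorem subPairing_fibers [Fintype W] (D : IsBlowUp adj lab adj' lab' α mult letter π ι)
    (hα : ∀ b, letter b ≠ α) (hinj : ∀ b c, mult b = mult c → letter b = letter c → b = c)
    (L : FreeMagma B) (S : Finset W) :
    subPairing adj lab (FreeMagma.lift (simpleBracket α mult letter) L) (fibers π S) =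
      (∏ v ∈ S, ((mult (lab' v)).factorial : ℤ)) * subPairing adj' lab' L S := by
  classical
  induction L generalizing S with
  | ih1 b => exact D.subPairing_fibers_of hα hinj b S
  | ih2 H K hH hK =>
    rw [map_mul, subPairing_mul, subPairing_mul, ← Fintype.sum_prod_type',
      ← Fintype.sum_prod_type', Finset.mul_sum]
    symm
    refine Fintype.sum_of_injective (Prod.map (fibers π) (fibers π))
      -- Cuts of `S` lift to cuts of its fibres; what remains is that any other cut contributes
      -- zero.
      (D.fibers_injective.prodMap D.fibers_injective) _ _ ?_ ?_
    · rintro ⟨T, U⟩ hTU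
      by_contra hc
      obtain ⟨h1, hc⟩ : T ∪ U = fibers π S ∧ _ := by
        by_cases h1 : T ∪ U = fibers π S
        · rw [if_pos h1] at hc
          exact ⟨h1, hc⟩
        · exact absurd (if_neg h1) hc
      rw [← ne_eq, mul_ne_zero_iff, mul_ne_zero_iff] at hc
      obtain ⟨h2, h3, h4⟩ := hc
      have hd := disjoint_of_link_ne_zero h2
      have key : ∀ x, x ∈ fibers π S → ι (π x) ∈ fibers π S := by
        intro x hx
        rwa [mem_fibers, D.proj_anchor, ← mem_fibers]
      -- By `anchor_mem` each leaf lies on the same side of the cut as its anchor, so both sides are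
      -- unions of fibres.
      have hT : fibers π ({v | ι v ∈ T} : Finset W) = T := by
        ext x
        simp only [mem_fibers, Finset.mem_filter, Finset.mem_univ, true_and]
        refine ⟨fun h => ?_, D.anchor_mem hα h3⟩
        have hx : x ∈ T ∪ U := by
          rw [h1, mem_fibers, ← D.proj_anchor (π x), ← mem_fibers, ← h1]
          exact Finset.mem_union_left _ h
        refine (Finset.mem_union.1 hx).resolve_right fun hxU => ?_
        exact Finset.disjoint_left.1 hd h (D.anchor_mem hα h4 hxU)
      have hU : fibers π ({v | ι v ∈ U} : Finset W) = U := by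
        ext x
        simp only [mem_fibers, Finset.mem_filter, Finset.mem_univ, true_and]
        refine ⟨fun h => ?_, D.anchor_mem hα h4⟩
        have hx : x ∈ T ∪ U := by
          rw [h1, mem_fibers, ← D.proj_anchor (π x), ← mem_fibers, ← h1]
          exact Finset.mem_union_right _ h
        refine (Finset.mem_union.1 hx).resolve_left fun hxT => ?_
        exact Finset.disjoint_left.1 hd (D.anchor_mem hα h3 hxT) h
      exact hTU ⟨(_, _), Prod.ext hT hU⟩
    · rintro ⟨T, U⟩
      simp only [Prod.map_apply]
      rw [← fibers_union, hH, hK, D.link_fibers]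
      by_cases h : T ∪ U = S
      · rw [if_pos h, if_pos (congrArg _ h)]
        by_cases hd : Disjoint T U
        · rw [← h, Finset.prod_union hd]
          ring
        · rw [link, if_neg hd]
          ring
      · rw [if_neg h, if_neg (fun h' => h (D.fibers_injective h')), mul_zero]

end IsBlowUp
end BlowUp
-- Block substitution on nested words, brackets and star graphs.
section Expand
variable {A B : Type u} (α : A) (mult : B → ℕ) (letter : B → A)

/-- Replacing every letter `b` of a nested word by the simple word `αⁿχ`, where `n` and `χ` depend
on `b`. -/
def NestedWord.expand : NestedWord B → NestedWord A
  | .letter b => .simple (.letter α) (mult b) (.letter (letter b))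
  | .simple M n N => .simple M.expand n N.expand

theorem NestedWord.bracket_expand (N : NestedWord B) :
    (N.expand α mult letter).bracket =
      FreeMagma.lift (simpleBracket α mult letter) N.bracket := by
  induction N with
  | letter b => rfl
  | simple M n N hM hN =>
    rw [expand, bracket, bracket, hM, hN]
    induction n with
    | zero => rfl
    | succ n ih =>
      rw [Function.iterate_succ_apply', Function.iterate_succ_apply', ih, FreeMagma.mul_eq,
        FreeMagma.mul_eq, map_mul]

variable {α mult letter}

/-- An expanded word is never a bare letter, so the simple words over `.letter α` coming from
letters cannot be confused with expansions of simple words. -/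
theorem NestedWord.expand_injective
    (hinj : ∀ b c, mult b = mult c → letter b = letter c → b = c) :
    Function.Injective (NestedWord.expand α mult letter) := by
  have simple_ne : ∀ (M N : NestedWord B) (a : A), M.expand α mult letter ≠ .letter a := by
    intro M N a h
    cases M <;> simp [expand] at h
  intro M
  induction M with
  | letter b =>
    intro N h
    cases N with
    | letter c =>
      simp only [expand, simple.injEq, NestedWord.letter.injEq, true_and] at h
      rw [hinj b c h.1 h.2]
    | simple N n N' =>
      simp only [expand, simple.injEq] at h
      exact absurd h.1.symm (simple_ne N N α)
  | simple M n M' hM hM' =>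
    intro N h
    cases N with
    | letter c =>
      simp only [expand, simple.injEq] at h
      exact absurd h.1 (simple_ne M M α)
    | simple N k N' =>
      simp only [expand, simple.injEq] at h
      rw [hM h.1, h.2.1, hM' h.2.2]

theorem isBlowUp_attach_single (n : ℕ) (b : B) (hb : mult b = n) :
    IsBlowUp ((AnchoredGraph.single α).attach n (AnchoredGraph.single (letter b))).graph.Adj
      ((AnchoredGraph.single α).attach n (AnchoredGraph.single (letter b))).label
      (AnchoredGraph.single b).graph.Adj (AnchoredGraph.single b).label α mult letter
      (fun _ => ()) (fun _ => .inr ()) where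
  proj_anchor _ := rfl
  adj_iff := by
    rintro (⟨i, ⟨⟩⟩ | ⟨⟨⟩⟩) (⟨j, ⟨⟩⟩ | ⟨⟨⟩⟩) <;> simp [AnchoredGraph.attach, AnchoredGraph.single]
  label_anchor _ := rfl
  label_leaf := by
    rintro (⟨i, ⟨⟩⟩ | ⟨⟩) h
    · rfl
    · exact absurd rfl h
  card_leaves := by
    rintro ⟨⟩
    have e : {x : (Fin n × Unit) ⊕ Unit | () = () ∧ x ≠ .inr ()} =
        Set.range fun i : Fin n => Sum.inl (i, ()) := by
      ext (⟨i, ⟨⟩⟩ | ⟨⟨⟩⟩) <;> simp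
    refine (congrArg Set.ncard e).trans ?_
    rw [Set.ncard_range_of_injective fun i j h => (Prod.mk.inj (Sum.inl_injective h)).1,
      Nat.card_fin]
    exact hb.symm

/-- Since `ι` and `κ` respect anchors, the new attaching edges upstairs lie exactly over those
downstairs and join anchors, never leaves. -/
theorem IsBlowUp.attach {G H : AnchoredGraph A} {G' H' : AnchoredGraph B}
    {π : G.V → G'.V} {ι : G'.V → G.V} {ρ : H.V → H'.V} {κ : H'.V → H.V}
    (D : IsBlowUp G.graph.Adj G.label G'.graph.Adj G'.label α mult letter π ι)
    (E : IsBlowUp H.graph.Adj H.label H'.graph.Adj H'.label α mult letter ρ κ)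
    (hι : ι G'.anchor = G.anchor) (hκ : κ H'.anchor = H.anchor) (n : ℕ) :
    IsBlowUp (G.attach n H).graph.Adj (G.attach n H).label
      (G'.attach n H').graph.Adj (G'.attach n H').label α mult letter
      (Sum.map (Prod.map id π) ρ) (Sum.map (Prod.map id ι) κ) where
  proj_anchor := by
    rintro (⟨i, v⟩ | v)
    · exact congrArg (fun x => Sum.inl (i, x)) (D.proj_anchor v)
    · exact congrArg Sum.inr (E.proj_anchor v)
  adj_iff := by
    rintro (⟨i, x⟩ | x) (⟨j, y⟩ | y)
    · simp only [AnchoredGraph.attach, Sum.map_inl, Prod.map_apply, id, D.adj_iff x y,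
        Sum.inl.injEq, Prod.mk.injEq, true_and, ne_eq]
      tauto
    · simp only [AnchoredGraph.attach, Sum.map_inl, Sum.map_inr, Prod.map_apply, id,
        Sum.inl.injEq, Sum.inr.injEq, Prod.mk.injEq, true_and, ne_eq, reduceCtorEq, false_and,
        or_false]
      constructor
      · rintro ⟨rfl, rfl⟩
        rw [← hι, ← hκ, D.proj_anchor, E.proj_anchor]
        simp
      · rintro ⟨h1, h2, h3, h4⟩
        rw [h1, h2, h3, h4]
        exact ⟨hι, hκ⟩
    · simp [AnchoredGraph.attach]
    · simp only [AnchoredGraph.attach, Sum.map_inr, E.adj_iff x y, Sum.inr.injEq, ne_eq]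
  label_anchor := by
    rintro (⟨i, v⟩ | v)
    · exact D.label_anchor v
    · exact E.label_anchor v
  label_leaf := by
    rintro (⟨i, x⟩ | x) h
    · exact D.label_leaf x fun hx => h (congrArg (fun y => Sum.inl (i, y)) hx)
    · exact E.label_leaf x fun hx => h (congrArg Sum.inr hx)
  card_leaves := by
    rintro (⟨i, v⟩ | v)
    · refine Eq.trans ?_ (D.card_leaves v)
      rw [← Set.ncard_image_of_injective (f := fun x => (Sum.inl (i, x) : (Fin n × G.V) ⊕ H.V)) _
        (fun x y h => (Prod.mk.inj (Sum.inl_injective h)).2)]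
      congr 1
      ext (⟨j, x⟩ | x)
      · constructor
        · rintro ⟨h1, h2⟩
          obtain ⟨rfl, h3⟩ := Prod.mk.inj (Sum.inl.inj h1)
          exact ⟨x, ⟨h3, fun h => h2 (congrArg (fun y => Sum.inl (j, y)) h)⟩, rfl⟩
        · rintro ⟨y, ⟨h1, h2⟩, h⟩
          obtain ⟨rfl, rfl⟩ := Prod.mk.inj (Sum.inl.inj h)
          exact ⟨congrArg (fun y => Sum.inl (i, y)) h1,
            fun h => h2 (Prod.mk.inj (Sum.inl.inj h)).2⟩
      · constructor
        · rintro ⟨h1, -⟩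
          exact absurd h1 Sum.inr_ne_inl
        · rintro ⟨y, -, h⟩
          exact absurd h Sum.inl_ne_inr
    · refine Eq.trans ?_ (E.card_leaves v)
      rw [← Set.ncard_image_of_injective (f := fun x => (Sum.inr x : (Fin n × G.V) ⊕ H.V)) _
        Sum.inr_injective]
      congr 1
      ext (⟨j, x⟩ | x)
      · constructor
        · rintro ⟨h1, -⟩
          exact absurd h1 Sum.inl_ne_inr
        · rintro ⟨y, -, h⟩
          exact absurd h Sum.inr_ne_inl
      · constructor
        · rintro ⟨h1, h2⟩
          exact ⟨x, ⟨Sum.inr.inj h1, fun h => h2 (congrArg Sum.inr h)⟩, rfl⟩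
        · rintro ⟨y, ⟨h1, h2⟩, h⟩
          obtain rfl := Sum.inr.inj h
          exact ⟨congrArg Sum.inr h1, fun h => h2 (Sum.inr.inj h)⟩

variable (α mult letter) in
theorem exists_isBlowUp_star (N : NestedWord B) :
    ∃ (π : (N.expand α mult letter).star.V → N.star.V)
      (ι : N.star.V → (N.expand α mult letter).star.V),
      IsBlowUp (N.expand α mult letter).star.graph.Adj (N.expand α mult letter).star.label
        N.star.graph.Adj N.star.label α mult letter π ι ∧
      ι N.star.anchor = (N.expand α mult letter).star.anchor := by
  induction N with
  | letter b => exact ⟨_, _, isBlowUp_attach_single _ b rfl, rfl⟩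
  | simple M n N hM hN =>
    obtain ⟨π, ι, D, hι⟩ := hM
    obtain ⟨ρ, κ, E, hκ⟩ := hN
    exact ⟨_, _, D.attach E hι hκ n, congrArg Sum.inr hκ⟩

/-- Up to a nonzero factor, the pairings in the two alphabets agree. -/
theorem pairing_expand (hα : ∀ b, letter b ≠ α)
    (hinj : ∀ b c, mult b = mult c → letter b = letter c → b = c) (M N : NestedWord B) :
    pairing (M.expand α mult letter).star.toLetterGraph (N.expand α mult letter).bracket ≠ 0 ↔
      pairing M.star.toLetterGraph N.bracket ≠ 0 := by
  classical
  obtain ⟨π, ι, D, -⟩ := exists_isBlowUp_star α mult letter M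
  have := (M.expand α mult letter).star.finite
  have := M.star.finite
  have := Fintype.ofFinite (M.expand α mult letter).star.V
  have := Fintype.ofFinite M.star.V
  rw [pairing_eq_subPairing, pairing_eq_subPairing, NestedWord.bracket_expand]
  have h := D.subPairing_fibers hα hinj N.bracket Finset.univ
  have e : IsBlowUp.fibers π Finset.univ = Finset.univ := by
    ext x
    simp [IsBlowUp.mem_fibers]
  rw [e] at h
  rw [h, mul_ne_zero_iff]
  refine and_iff_right (Finset.prod_ne_zero_iff.2 fun v _ => ?_)
  exact_mod_cast Nat.factorial_ne_zero _

end Expand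

/-! ### Lyndon-Shirshov words in the alphabet of blocks. -/

section Order
variable {A : Type u} [LinearOrder A]

theorem isLyndon_iff {w : List A} :
    IsLyndon w ↔ w ≠ [] ∧ ∀ x y, x ≠ [] → y ≠ [] → w = x ++ y → w < y ++ x := by
  refine and_congr_right fun _ => ⟨?_, ?_⟩
  · rintro h x y hx hy rfl
    have := h x.length (List.length_pos_iff.2 hx) (by simp [List.length_pos_iff.2 hy])
    rwa [List.rotate_append_length_eq] at this
  · intro h k hk hkw
    rw [List.rotate_eq_drop_append_take hkw.le]
    refine h _ _ ?_ ?_ (List.take_append_drop k w).symm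
    · exact fun h => by simp [List.take_eq_nil_iff] at h; rcases h with h | h <;> simp_all
    · rw [ne_eq, List.drop_eq_nil_iff]
      omega

theorem isLyndon_singleton (a : A) : IsLyndon [a] := by
  refine ⟨by simp, fun k h1 h2 => ?_⟩
  rw [List.length_singleton] at h2
  omega

theorem IsLyndon.head_le {a : A} {l : List A} (h : IsLyndon (a :: l)) : ∀ x ∈ a :: l, a ≤ x := by
  intro x hx
  rcases List.mem_cons.1 hx with rfl | hx
  · exact le_rfl
  · obtain ⟨s, t, rfl⟩ := List.append_of_mem hx
    have := (isLyndon_iff.1 h).2 (a :: s) (x :: t) (by simp) (by simp) rfl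
    rw [List.cons_append, List.cons_lt_cons_iff] at this
    rcases this with h | h
    · exact h.le
    · exact h.1.le

theorem IsLyndon.getLast?_ne {a : A} {l : List A} (h : IsLyndon (a :: l)) (hl : l ≠ []) :
    (a :: l).getLast? ≠ some a := by
  obtain ⟨s, z, rfl⟩ := List.eq_nil_or_concat l |>.resolve_left hl
  intro hc
  have hz : z = a := by simpa [List.getLast?_cons] using hc
  subst hz
  exact IsLyndon.no_border (x := [z]) (y := s) (by simp) (by simpa using h)

/-- The words `αⁿχ` with `α < χ`, in their lexicographic order. -/
abbrev Block (α : A) : Type u := ℕᵒᵈ ×ₗ {χ : A // α < χ}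

namespace Block
variable {α : A}

/-- The word `αⁿχ`. -/
def make (n : ℕ) (χ : A) (h : α < χ) : Block α := toLex (OrderDual.toDual n, ⟨χ, h⟩)

/-- The number `n` in the word `αⁿχ`. -/
def mult (b : Block α) : ℕ := OrderDual.ofDual (ofLex b).1

/-- The letter `χ` in the word `αⁿχ`. -/
def letter (b : Block α) : A := (ofLex b).2

theorem lt_letter (b : Block α) : α < b.letter := (ofLex b).2.2

theorem letter_ne (b : Block α) : b.letter ≠ α := b.lt_letter.ne'

@[simp]
theorem mult_make (n : ℕ) (χ : A) (h : α < χ) : (make n χ h).mult = n := rfl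

@[simp]
theorem letter_make (n : ℕ) (χ : A) (h : α < χ) : (make n χ h).letter = χ := rfl

theorem ext (b c : Block α) (h1 : b.mult = c.mult) (h2 : b.letter = c.letter) : b = c :=
  ofLex.injective (Prod.ext h1 (Subtype.ext h2))

/-- More copies of the smaller letter `α` make a word lexicographically smaller, which is why the
order of `n` is reversed. -/
theorem lt_iff (b c : Block α) :
    b < c ↔ c.mult < b.mult ∨ b.mult = c.mult ∧ b.letter < c.letter := by
  rw [Prod.Lex.lt_iff]
  rfl

/-- The word `αⁿχ` as a list. -/
def word (b : Block α) : List A := List.replicate b.mult α ++ [b.letter]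

theorem word_ne_nil (b : Block α) : b.word ≠ [] := by simp [word]

end Block

theorem replicate_append_lt {a x : A} (h : a < x) {k n : ℕ} (hkn : k < n) (s t : List A) :
    List.replicate n a ++ s < List.replicate k a ++ x :: t := by
  induction k generalizing n with
  | zero =>
    obtain ⟨n, rfl⟩ := Nat.exists_eq_add_of_lt hkn
    rw [List.replicate_succ, List.cons_append, List.replicate_zero, List.nil_append]
    exact List.cons_lt_cons_iff.2 (Or.inl h)
  | succ k ih =>
    obtain ⟨n, rfl⟩ : ∃ m, n = m + 1 := ⟨n - 1, by omega⟩
    rw [List.replicate_succ, List.cons_append, List.replicate_succ, List.cons_append]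
    exact List.cons_lt_cons_iff.2 (Or.inr ⟨rfl, ih (by omega)⟩)

variable {α : A}

/-- Two distinct blocks differ at a position inside both of them, so what follows is irrelevant.
This makes `flat` strictly monotone. -/
theorem Block.word_append_lt {b c : Block α} (h : b < c) (s t : List A) :
    b.word ++ s < c.word ++ t := by
  rw [Block.word, Block.word, List.append_assoc, List.append_assoc]
  rcases (Block.lt_iff b c).1 h with h | ⟨h1, h2⟩
  · exact replicate_append_lt c.lt_letter h _ _
  · rw [h1]
    exact List.append_left_lt (List.cons_lt_cons_iff.2 (Or.inl h2))

/-- The word in the original alphabet. -/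
def flat (u : List (Block α)) : List A := u.flatMap Block.word

@[simp]
theorem flat_nil : flat ([] : List (Block α)) = [] := rfl

@[simp]
theorem flat_cons (b : Block α) (u : List (Block α)) : flat (b :: u) = b.word ++ flat u := rfl

@[simp]
theorem flat_append (u v : List (Block α)) : flat (u ++ v) = flat u ++ flat v :=
  List.flatMap_append

theorem flat_eq_nil {u : List (Block α)} : flat u = [] ↔ u = [] := by
  cases u with
  | nil => simp
  | cons b u => simp [b.word_ne_nil]

theorem flat_strictMono : StrictMono (flat : List (Block α) → List A) := by
  intro u
  induction u with
  | nil =>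
    intro v h
    cases v with
    | nil => exact absurd h (lt_irrefl _)
    | cons c v =>
      rw [flat_nil]
      cases hv : flat (c :: v) with
      | nil => exact absurd (flat_eq_nil.1 hv) (by simp)
      | cons x l => exact List.nil_lt_cons _ _
  | cons b u ih =>
    intro v h
    cases v with
    | nil => exact absurd h (List.not_lt_nil _)
    | cons c v =>
      rw [flat_cons, flat_cons]
      rcases List.cons_lt_cons_iff.1 h with h1 | ⟨rfl, h1⟩
      · exact Block.word_append_lt h1 _ _
      · exact List.append_left_lt (ih h1)

/-- The condition `t ≠ []` assigns a cut between two blocks to the beginning of the right one, where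
`s = []`. -/
theorem exists_flat_split {u : List (Block α)} {p q : List A} (h : flat u = p ++ q) (hq : q ≠ []) :
    ∃ x b y s t, u = x ++ b :: y ∧ b.word = s ++ t ∧ t ≠ [] ∧ p = flat x ++ s ∧
      q = t ++ flat y := by
  induction u generalizing p with
  | nil =>
    rw [flat_nil] at h
    exact absurd (List.append_eq_nil_iff.1 h.symm).2 hq
  | cons b u ih =>
    rw [flat_cons, List.append_eq_append_iff] at h
    rcases h with ⟨p', rfl, h⟩ | ⟨t, h, rfl⟩
    · obtain ⟨x, c, y, s, t, rfl, h1, h2, rfl, h3⟩ := ih h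
      exact ⟨b :: x, c, y, s, t, rfl, h1, h2, by simp, h3⟩
    · by_cases ht : t = []
      · subst ht
        obtain ⟨x, c, y, s, t, rfl, h1, h2, h4, h3⟩ := ih (p := []) rfl
        refine ⟨b :: x, c, y, s, t, rfl, h1, h2, ?_, h3⟩
        rw [flat_cons, List.append_assoc, ← h4, h]
        simp
      · exact ⟨[], b, u, p, t, rfl, h, ht, rfl, rfl⟩

/-- Rotations at block boundaries are the rotations of `u`. A rotation starting inside a block `b`
begins with fewer copies of `α` than the one starting at the front of `b`, hence is larger than it,
and the latter is at least the word itself. -/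
theorem isLyndon_flat_iff {u : List (Block α)} : IsLyndon (flat u) ↔ IsLyndon u := by
  rw [isLyndon_iff, isLyndon_iff, ne_eq, flat_eq_nil]
  refine and_congr_right fun hu => ⟨?_, ?_⟩
  · rintro h x y hx hy rfl
    rw [← flat_strictMono.lt_iff_lt, flat_append y x]
    exact h _ _ (mt flat_eq_nil.1 hx) (mt flat_eq_nil.1 hy) (flat_append x y)
  · rintro h p q hp hq hpq
    obtain ⟨x, b, y, s, t, rfl, h1, h2, rfl, rfl⟩ := exists_flat_split hpq hq
    by_cases hs : s = []
    · subst hs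
      rw [List.append_nil] at hp ⊢
      rw [List.nil_append] at h1
      have := flat_strictMono (h x (b :: y) (mt flat_eq_nil.2 hp) (by simp) rfl)
      rwa [flat_append (b :: y) x, flat_cons b y, h1] at this
    -- Equality occurs when `b` is the first block; the next comparison is the strict one.
    · have hle : flat (x ++ b :: y) ≤ flat (b :: y ++ x) := by
        by_cases hx : x = []
        · subst hx
          simp
        · exact (flat_strictMono (h x (b :: y) hx (by simp) rfl)).le
      refine hle.trans_lt ?_
      have ht : ∃ k < b.mult, t = List.replicate k α ++ [b.letter] := by
        rw [Block.word, List.append_eq_append_iff] at h1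
        rcases h1 with ⟨a', rfl, h3⟩ | ⟨c', h3, rfl⟩
        · have := congrArg List.length h3
          have h4 := List.length_pos_iff.2 h2
          simp at this
          have h5 : a' = [] := List.length_eq_zero_iff.1 (by omega)
          subst h5
          refine ⟨0, ?_, by simpa using h3.symm⟩
          by_contra hc
          apply hs
          simp [show b.mult = 0 by omega]
        · obtain ⟨h5, -, h6⟩ := List.append_eq_replicate_iff.1 h3.symm
          refine ⟨c'.length, ?_, by rw [← h6]⟩
          have := List.length_pos_iff.2 hs
          omega
      obtain ⟨k, hk, rfl⟩ := ht
      rw [List.cons_append, flat_cons, Block.word]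
      simp only [List.append_assoc, List.cons_append, List.nil_append]
      exact replicate_append_lt b.lt_letter hk _ _

theorem exists_flat {w : List A} (hw : ∀ x ∈ w, α ≤ x) (hlast : w.getLast? ≠ some α) :
    ∃ u : List (Block α), flat u = w := by
  induction w with
  | nil => exact ⟨[], rfl⟩
  | cons x l ih =>
    by_cases hl : l = []
    · subst hl
      have hx : x ≠ α := by simpa using hlast
      exact ⟨[Block.make 0 x (lt_of_le_of_ne (hw x (by simp)) hx.symm)], by simp [Block.word]⟩
    · obtain ⟨u, hu⟩ := ih (fun y hy => hw y (List.mem_cons_of_mem _ hy)) (by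
        rw [List.getLast?_cons, List.getLast?_eq_some_getLast hl] at hlast
        rw [List.getLast?_eq_some_getLast hl]
        simpa using hlast)
      by_cases hx : x = α
      · subst hx
        cases u with
        | nil => exact absurd hu.symm hl
        | cons b u =>
          refine ⟨Block.make (b.mult + 1) b.letter b.lt_letter :: u, ?_⟩
          rw [← hu]
          simp [Block.word, List.replicate_succ]
      · refine ⟨Block.make 0 x (lt_of_le_of_ne (hw x (by simp)) (Ne.symm hx)) :: u, ?_⟩
        rw [flat_cons, hu]
        simp [Block.word]

/-- The first simple partition of the flat word recovers the blocks, because its first letter is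
`α`. Later partitions of `u` are transported by `expand`, whose injectivity preserves the condition
that the last letter of a simple word differs from the repeated one. -/
theorem isFullPartition_flat {u : List (Block α)} {N : NestedWord (Block α)}
    (hu : (flat u).head? = some α) (h : IsFullPartition u N) :
    IsFullPartition (flat u) (N.expand α Block.mult Block.letter) := by
  have hinj := NestedWord.expand_injective (α := α) (B := Block α) Block.ext
  have h1 : IsSimplePartition ((flat u).map NestedWord.letter)
      ((u.map NestedWord.letter).map (NestedWord.expand α Block.mult Block.letter)) := by
    refine ⟨.letter α, u.map fun b => (b.mult, .letter b.letter), ?_, ?_, ?_, ?_⟩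
    · rw [List.head?_map, hu]
      rfl
    · intro q hq
      obtain ⟨b, -, rfl⟩ := List.mem_map.1 hq
      simpa using b.letter_ne
    · clear hu h
      induction u with
      | nil => rfl
      | cons b u ih =>
        rw [flat_cons, List.map_append, ih]
        simp [Block.word]
    · rw [List.map_map, List.map_map]
      rfl
  refine Relation.ReflTransGen.head h1 ?_
  refine Relation.ReflTransGen.lift
    (List.map (NestedWord.expand α Block.mult Block.letter)) (fun p q => ?_) _ _ h
  rintro ⟨M, parts, h2, h3, rfl, rfl⟩
  refine ⟨M.expand α Block.mult Block.letter,
    parts.map fun r => (r.1, r.2.expand α Block.mult Block.letter), ?_, ?_, ?_, ?_⟩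
  · rw [List.head?_map, h2]
    rfl
  · intro r hr
    obtain ⟨q, hq, rfl⟩ := List.mem_map.1 hr
    exact hinj.ne (h3 q hq)
  · rw [List.map_flatMap, List.flatMap_map]
    refine List.flatMap_congr fun r _ => ?_
    simp
  · rw [List.map_map, List.map_map]
    rfl

theorem fullPartition_eq {w : LyndonWord A} {N : NestedWord A} (h : IsFullPartition w.1 N) :
    fullPartition w = N :=
  (fullPartition_spec w).unique h

theorem fullPartition_singleton (a : A) :
    fullPartition ⟨[a], isLyndon_singleton a⟩ = .letter a :=
  fullPartition_eq Relation.ReflTransGen.refl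

/-- The Lyndon-Shirshov word in the original alphabet. -/
def flatLyndon (u : LyndonWord (Block α)) : LyndonWord A := ⟨flat u.1, isLyndon_flat_iff.2 u.2⟩

theorem fullPartition_flatLyndon (u : LyndonWord (Block α)) (hu : (flat u.1).head? = some α) :
    fullPartition (flatLyndon u) = (fullPartition u).expand α Block.mult Block.letter :=
  fullPartition_eq (isFullPartition_flat hu (fullPartition_spec u))

theorem leftGreedy_flatLyndon (u : LyndonWord (Block α)) (hu : (flat u.1).head? = some α) :
    leftGreedy (flatLyndon u) =
      FreeMagma.lift (simpleBracket α Block.mult Block.letter) (leftGreedy u) := by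
  rw [leftGreedy, fullPartition_flatLyndon u hu, NestedWord.bracket_expand]
  rfl

theorem exists_flatLyndon (w : LyndonWord A) (hw : w.1.head? = some α) (hl : 1 < w.1.length) :
    ∃ u : LyndonWord (Block α), flatLyndon u = w := by
  obtain ⟨w, h⟩ := w
  cases w with
  | nil => simp at hw
  | cons a l =>
    obtain rfl : a = α := by simpa using hw
    obtain ⟨u, hu⟩ := exists_flat h.head_le (h.getLast?_ne (by rintro rfl; simp at hl))
    exact ⟨⟨u, isLyndon_flat_iff.1 (hu ▸ h)⟩, Subtype.ext hu⟩

/-- No block is empty, and a block in which `α` occurs also has its final letter. The strict drop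
drives both inductions below. -/
theorem length_lt_length_flat {u : List (Block α)} (hu : α ∈ flat u) :
    u.length < (flat u).length := by
  have h : ∀ v : List (Block α), v.length ≤ (flat v).length := by
    intro v
    induction v with
    | nil => simp
    | cons b v ih =>
      simp [Block.word]
      omega
  induction u with
  | nil => simp at hu
  | cons b u ih =>
    rw [flat_cons, List.mem_append] at hu
    rw [flat_cons, List.length_append, List.length_cons]
    rcases hu with hu | hu
    · have h1 := h u
      have h2 : b.mult ≠ 0 := by
        intro h0
        rw [Block.word, h0] at hu
        simp at hu
        exact b.letter_ne hu.symm
      simp [Block.word]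
      omega
    · have := ih hu
      simp [Block.word]
      omega

end Order

/-! ### Letter content as an obstruction to a nonzero pairing. -/

section Content
variable {A : Type u}

theorem IsFullPartition.word_eq {w : List A} {N : NestedWord A} (h : IsFullPartition w N) :
    N.word = w := by
  have key : ∀ u v : List (NestedWord A), Relation.ReflTransGen IsSimplePartition u v →
      v.flatMap NestedWord.word = u.flatMap NestedWord.word := by
    intro u v h
    induction h with
    | refl => rfl
    | tail _ h ih =>
      obtain ⟨α, parts, -, -, rfl, rfl⟩ := h
      rw [flatMap_word_parts, ih]
  have := key _ _ h
  rw [List.flatMap_map] at this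
  simpa [NestedWord.word] using this

theorem letters_bracket (N : NestedWord A) : letters N.bracket = (N.word : Multiset A) := by
  induction N with
  | letter a => simp [NestedWord.bracket, NestedWord.word, letters]
  | simple M n N hM hN =>
    rw [NestedWord.bracket, NestedWord.word]
    induction n with
    | zero => simpa using hN
    | succ n ih =>
      rw [Function.iterate_succ_apply', FreeMagma.mul_eq, letters_mul, ih, hM,
        List.replicate_succ, List.flatten_cons, List.append_assoc]
      simp only [← Multiset.coe_add]

/-- Quantified over all `Fintype` instances, as the vertex types are only known to be `Finite`. -/
theorem sum_label_star (N : NestedWord A) : ∀ [Fintype N.star.V],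
    ∑ x : N.star.V, ({N.star.label x} : Multiset A) = (N.word : Multiset A) := by
  induction N with
  | letter a =>
    intro inst
    obtain rfl : inst = inferInstanceAs (Fintype Unit) := Subsingleton.elim _ _
    rfl
  | simple M n N hM hN =>
    intro inst
    have := M.star.finite
    have := N.star.finite
    have := Fintype.ofFinite M.star.V
    have := Fintype.ofFinite N.star.V
    obtain rfl : inst = inferInstanceAs (Fintype ((Fin n × M.star.V) ⊕ N.star.V)) :=
      Subsingleton.elim _ _
    refine (Fintype.sum_sum_type (fun x : (Fin n × M.star.V) ⊕ N.star.V =>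
      ({(NestedWord.simple M n N).star.label x} : Multiset A))).trans ?_
    rw [Fintype.sum_prod_type]
    refine (congrArg₂ (· + ·) (Finset.sum_congr rfl fun i _ => hM) hN).trans ?_
    rw [NestedWord.word, ← Multiset.coe_add, Finset.sum_const, Finset.card_univ, Fintype.card_fin]
    congr 1
    induction n with
    | zero => simp
    | succ n ih =>
      rw [succ_nsmul', List.replicate_succ, List.flatten_cons, ← Multiset.coe_add, ih]

theorem word_eq_of_pairing_ne_zero [LinearOrder A] {w : LyndonWord A} {L : FreeMagma A}
    (h : pairing (starGraph w) L ≠ 0) : (w.1 : Multiset A) = letters L := by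
  have := (starGraph w).finite
  have := Fintype.ofFinite (starGraph w).V
  rw [pairing_eq_subPairing] at h
  rw [← sum_label_eq_letters h, ← (fullPartition_spec w).word_eq]
  exact (@sum_label_star A (fullPartition w) this).symm

theorem letters_leftGreedy [LinearOrder A] (w : LyndonWord A) :
    letters (leftGreedy w) = (w.1 : Multiset A) := by
  rw [leftGreedy, letters_bracket, (fullPartition_spec w).word_eq]

end Content

/-! ### Diagonality of the pairing. -/

section Diagonal

theorem pairing_single_ne_zero {A : Type u} (a : A) :
    pairing (AnchoredGraph.single a).toLetterGraph (.of a) ≠ 0 := by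
  classical
  have : Fintype (AnchoredGraph.single a).V := inferInstanceAs (Fintype Unit)
  rw [pairing_eq_subPairing, subPairing_of, if_pos]
  · exact one_ne_zero
  · exact ⟨(), Finset.ext fun x => iff_of_true (Finset.mem_univ x)
      (Finset.mem_singleton.2 (Subsingleton.elim (α := Unit) x ())), rfl⟩

/-- A Lyndon-Shirshov word begins with its smallest letter, so words with equal content have the
same `α` and can be recoded in the same blocks. -/
theorem head?_eq_of_perm {A : Type u} [LinearOrder A] {w : LyndonWord A} {m : Multiset A}
    (hw : (w.1 : Multiset A) = m) {α : A} (hα : α ∈ m) (hmin : ∀ x ∈ m, α ≤ x) :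
    w.1.head? = some α := by
  subst hw
  obtain ⟨w, h⟩ := w
  cases w with
  | nil => simp at hα
  | cons a l => exact congrArg some (le_antisymm (h.head_le _ hα) (hmin a (by simp)))

/-- The star graphs and the left-greedy brackets of Lyndon-Shirshov words are dual to each other,
up to nonzero factors. -/
theorem pairing_ne_zero_iff (m : ℕ) : ∀ {A : Type u} [LinearOrder A] (w w' : LyndonWord A),
    w.1.length = m → (pairing (starGraph w) (leftGreedy w') ≠ 0 ↔ w = w') := by
  induction m using Nat.strong_induction_on with
  | _ m ih =>
    intro A _ w w' hm
    by_cases hperm : (w.1 : Multiset A) = w'.1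
    swap
    · refine iff_of_false (fun h => hperm ?_) fun h => hperm (by rw [h])
      rw [word_eq_of_pairing_ne_zero h, letters_leftGreedy]
    have hlen : w.1.length = w'.1.length := by
      simpa using congrArg Multiset.card hperm
    have hpos : 0 < w.1.length := List.length_pos_iff.2 w.2.1
    by_cases h1 : w.1.length = 1
    · obtain ⟨w, hw⟩ := w
      obtain ⟨w', hw'⟩ := w'
      obtain ⟨a, rfl⟩ := List.length_eq_one_iff.1 h1
      obtain ⟨b, rfl⟩ := List.length_eq_one_iff.1 (hlen ▸ h1)
      obtain rfl : a = b := by simpa using hperm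
      refine iff_of_true ?_ rfl
      have h2 := fullPartition_singleton a
      rw [starGraph, leftGreedy, h2]
      exact pairing_single_ne_zero a
    · obtain ⟨α, l, hαl⟩ := List.exists_cons_of_ne_nil w.2.1
      have hα : α ∈ w.1 := by simp [hαl]
      have hmin : ∀ x ∈ w.1, α ≤ x := by
        have := w.2
        rw [hαl] at this ⊢
        exact this.head_le
      have head : w.1.head? = some α := head?_eq_of_perm rfl hα hmin
      have head' : w'.1.head? = some α := head?_eq_of_perm hperm.symm hα hmin
      obtain ⟨u, rfl⟩ := exists_flatLyndon w head (by omega)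
      obtain ⟨u', rfl⟩ := exists_flatLyndon w' head' (by omega)
      -- The alphabet changes to `Block α`, hence the quantification over `A` inside the induction.
      have h2 := ih u.1.length (hm ▸ length_lt_length_flat hα) u u' rfl
      rw [starGraph, leftGreedy, fullPartition_flatLyndon u head,
        fullPartition_flatLyndon u' head', pairing_expand Block.letter_ne Block.ext]
      refine Iff.trans h2 ⟨fun h => by rw [h], fun h => Subtype.ext ?_⟩
      exact flat_strictMono.injective (congrArg Subtype.val h)

end Diagonal

/-! ### Elimination of the smallest letter in the free Lie algebra. -/

section Elimination
variable (K : Type v) [Field K] {A : Type u} [LinearOrder A] (α : A)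

/-- The homomorphism of free Lie algebras which replaces each letter `αⁿχ` by its left-greedy
bracketing. -/
noncomputable def flatHom : FreeLieAlgebra K (Block α) →ₗ⁅K⁆ FreeLieAlgebra K A :=
  FreeLieAlgebra.lift K fun b => toLie K (simpleBracket α Block.mult Block.letter b)

variable {α}

theorem flatHom_of (b : Block α) :
    flatHom K α (toLie K (.of b)) = toLie K (simpleBracket α Block.mult Block.letter b) := by
  rw [toLie_of, flatHom, FreeLieAlgebra.lift_of_apply]

theorem flatHom_toLie (L : FreeMagma (Block α)) :
    flatHom K α (toLie K L) =
      toLie K (FreeMagma.lift (simpleBracket α Block.mult Block.letter) L) := by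
  induction L with
  | ih1 b => exact flatHom_of K b
  | ih2 L M hL hM => rw [toLie_mul, map_mul, toLie_mul, LieHom.map_lie, hL, hM]

/-- The letters in the original alphabet. -/
def flatLetters (m : Multiset (Block α)) : Multiset A := m.bind fun b => (b.word : Multiset A)

theorem flatLetters_coe (u : List (Block α)) :
    flatLetters (u : Multiset (Block α)) = (flat u : Multiset A) := by
  rw [flatLetters, Multiset.coe_bind]
  rfl

/-- The span of the Lie bracket expressions in the letters `αⁿχ` with given underlying letters. -/
noncomputable def eliminated (m : Multiset A) : Submodule K (FreeLieAlgebra K A) :=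
  Submodule.span K
    {x | ∃ L : FreeMagma (Block α), flatLetters (letters L) = m ∧ x = flatHom K α (toLie K L)}

variable {K}

theorem lie_mem_eliminated {m n : Multiset A} {x y : FreeLieAlgebra K A}
    (hx : x ∈ eliminated K (α := α) m) (hy : y ∈ eliminated K (α := α) n) :
    ⁅x, y⁆ ∈ eliminated K (α := α) (m + n) := by
  induction hx using Submodule.span_induction with
  | mem x hx =>
    obtain ⟨L, rfl, rfl⟩ := hx
    induction hy using Submodule.span_induction with
    | mem y hy =>
      obtain ⟨M, rfl, rfl⟩ := hy
      refine Submodule.subset_span ⟨L * M, ?_, ?_⟩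
      · rw [letters_mul, flatLetters, Multiset.add_bind]
        rfl
      · rw [toLie_mul, LieHom.map_lie]
    | zero => simp
    | add y z _ _ hy hz =>
      rw [lie_add]
      exact add_mem hy hz
    | smul c y _ hy =>
      rw [lie_smul]
      exact Submodule.smul_mem _ c hy
  | zero => simp
  | add x z _ _ hx hz =>
    rw [add_lie]
    exact add_mem hx hz
  | smul c x _ hx =>
    rw [smul_lie]
    exact Submodule.smul_mem _ c hx

/-- `ad α` sends the block `αⁿχ` to `αⁿ⁺¹χ`, and it is a derivation, so it preserves the span of
brackets of blocks. Content is recorded because the spanning argument needs it to bound the number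
of blocks and to find first letters. -/
theorem of_lie_flatHom_mem (L : FreeMagma (Block α)) :
    ⁅toLie K (.of α), flatHom K α (toLie K L)⁆ ∈
      eliminated K (α := α) ({α} + flatLetters (letters L)) := by
  induction L with
  | ih1 b =>
    refine Submodule.subset_span
      ⟨.of (Block.make (b.mult + 1) b.letter b.lt_letter), ?_, ?_⟩
    · rw [letters_of, letters_of, flatLetters, flatLetters, Multiset.singleton_bind,
        Multiset.singleton_bind]
      rfl
    · rw [flatHom_of, flatHom_of, simpleBracket, simpleBracket, Block.mult_make,
        Block.letter_make, Function.iterate_succ_apply', toLie_mul]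
  | ih2 L M hL hM =>
    rw [toLie_mul, LieHom.map_lie, leibniz_lie, letters_mul, flatLetters, Multiset.add_bind]
    refine add_mem ?_ ?_
    · rw [← add_assoc]
      exact lie_mem_eliminated hL (Submodule.subset_span ⟨M, rfl, rfl⟩)
    · rw [add_left_comm]
      exact lie_mem_eliminated (Submodule.subset_span ⟨L, rfl, rfl⟩) hM

theorem of_lie_mem {m : Multiset A} {x : FreeLieAlgebra K A}
    (hx : x ∈ eliminated K (α := α) m) :
    ⁅toLie K (.of α), x⁆ ∈ eliminated K (α := α) ({α} + m) := by
  induction hx using Submodule.span_induction with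
  | mem x hx =>
    obtain ⟨L, rfl, rfl⟩ := hx
    exact of_lie_flatHom_mem L
  | zero => simp
  | add y z _ _ hy hz =>
    rw [lie_add]
    exact add_mem hy hz
  | smul c y _ hy =>
    rw [lie_smul]
    exact Submodule.smul_mem _ c hy

/-- Elimination of the smallest letter. -/
theorem toLie_mem_eliminated (L : FreeMagma A) (hL : ∀ x ∈ letters L, α ≤ x) :
    L = .of α ∨ toLie K L ∈ eliminated K (α := α) (letters L) := by
  induction L with
  | ih1 a =>
    rcases (hL a (by simp [letters_of])).eq_or_lt with rfl | h
    · exact Or.inl rfl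
    · refine Or.inr (Submodule.subset_span ⟨.of (Block.make 0 a h), ?_, ?_⟩)
      · rw [letters_of, letters_of, flatLetters, Multiset.singleton_bind]
        rfl
      · rw [flatHom_of]
        rfl
  | ih2 L M hL' hM' =>
    rw [letters_mul] at hL ⊢
    rw [toLie_mul]
    right
    -- The bare letter `α` is the exception: `[α, α] = 0`, and brackets with one factor `α` fall
    -- under `ad α`, up to sign.
    rcases hL' fun x hx => hL x (Multiset.mem_add.2 (Or.inl hx)) with rfl | h1 <;>
      rcases hM' fun x hx => hL x (Multiset.mem_add.2 (Or.inr hx)) with rfl | h2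
    · rw [lie_self]
      exact zero_mem _
    · rw [letters_of]
      exact of_lie_mem h2
    · rw [letters_of, ← lie_skew, add_comm]
      exact neg_mem (of_lie_mem h1)
    · exact lie_mem_eliminated h1 h2

end Elimination

/-! ### The left-greedy brackets span. -/

section Spanning
variable (K : Type v) [Field K]

theorem exists_min_letter {A : Type u} [LinearOrder A] (L : FreeMagma A) :
    ∃ α ∈ letters L, ∀ x ∈ letters L, α ≤ x := by
  induction L with
  | ih1 a => exact ⟨a, by simp [letters_of], by simp [letters_of]⟩
  | ih2 L M hL hM =>
    obtain ⟨a, ha, ha'⟩ := hL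
    obtain ⟨b, hb, hb'⟩ := hM
    rw [letters_mul]
    rcases le_total a b with h | h
    · refine ⟨a, Multiset.mem_add.2 (Or.inl ha), fun x hx => ?_⟩
      exact (Multiset.mem_add.1 hx).elim (ha' x) fun hx => h.trans (hb' x hx)
    · refine ⟨b, Multiset.mem_add.2 (Or.inr hb), fun x hx => ?_⟩
      exact (Multiset.mem_add.1 hx).elim (fun hx => h.trans (ha' x hx)) (hb' x)

/-- Elimination rewrites the expression in blocks. Induction expresses the result through
left-greedy brackets over `Block α`, which `flatHom` carries to left-greedy brackets over `A`. -/
theorem toLie_mem_span_leftGreedy (m : ℕ) : ∀ {A : Type u} [LinearOrder A] (L : FreeMagma A),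
    (letters L).card = m → toLie K L ∈ Submodule.span K
      {x | ∃ w : LyndonWord A, (w.1 : Multiset A) = letters L ∧ x = toLie K (leftGreedy w)} := by
  induction m using Nat.strong_induction_on with
  | _ m ih =>
    intro A _ L hm
    obtain ⟨α, hα, hmin⟩ := exists_min_letter L
    rcases toLie_mem_eliminated (K := K) L hmin with rfl | h
    · refine Submodule.subset_span ⟨⟨[α], isLyndon_singleton α⟩, by simp [letters_of], ?_⟩
      rw [leftGreedy, fullPartition_singleton]
      rfl
    · refine Submodule.span_le.2 ?_ h
      rintro _ ⟨L', hL', rfl⟩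
      -- The count drops strictly because `α` occurs in `L`.
      have hlt : (letters L').card < m := by
        obtain ⟨u, hu⟩ := Quot.exists_rep (letters L')
        have hu' : (u : Multiset (Block α)) = letters L' := hu
        rw [← hu', flatLetters_coe] at hL'
        rw [← hu', ← hm, ← hL', Multiset.coe_card, Multiset.coe_card]
        rw [← hL'] at hα
        exact length_lt_length_flat hα
      have h1 := Submodule.mem_map_of_mem (f := (flatHom K α).toLinearMap) (ih _ hlt L' rfl)
      rw [Submodule.map_span] at h1
      refine Submodule.span_mono ?_ h1
      rintro _ ⟨_, ⟨u, hu, rfl⟩, rfl⟩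
      have hcont : (((flatLyndon u).1 : List A) : Multiset A) = letters L := by
        rw [← hL', ← hu, flatLetters_coe]
        rfl
      refine ⟨flatLyndon u, hcont, ?_⟩
      rw [leftGreedy_flatLyndon u (head?_eq_of_perm hcont hα hmin), ← flatHom_toLie]
      rfl

/-- The span is a Lie subalgebra containing the generators. Mapping the free Lie algebra into it and
including back fixes the generators, so it is the identity. -/
theorem span_range_toLie (A : Type u) :
    Submodule.span K (Set.range (toLie K : FreeMagma A → FreeLieAlgebra K A)) = ⊤ := by
  let S : LieSubalgebra K (FreeLieAlgebra K A) :=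
    { Submodule.span K (Set.range (toLie K : FreeMagma A → FreeLieAlgebra K A)) with
      lie_mem' := by
        intro x y hx hy
        change x ∈ Submodule.span K _ at hx
        change y ∈ Submodule.span K _ at hy
        change ⁅x, y⁆ ∈ Submodule.span K _
        induction hx using Submodule.span_induction with
        | mem x hx =>
          obtain ⟨L, rfl⟩ := hx
          induction hy using Submodule.span_induction with
          | mem y hy =>
            obtain ⟨M, rfl⟩ := hy
            exact Submodule.subset_span ⟨L * M, toLie_mul K L M⟩
          | zero => simp
          | add y z _ _ hy hz =>
            rw [lie_add]
            exact add_mem hy hz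
          | smul c y _ hy =>
            rw [lie_smul]
            exact Submodule.smul_mem _ c hy
        | zero => simp
        | add x z _ _ hx hz =>
          rw [add_lie]
          exact add_mem hx hz
        | smul c x _ hx =>
          rw [smul_lie]
          exact Submodule.smul_mem _ c hx }
  have hS : ∀ a, FreeLieAlgebra.of K a ∈ S := fun a =>
    Submodule.subset_span ⟨.of a, toLie_of K a⟩
  have h : S.incl.comp (FreeLieAlgebra.lift K fun a => (⟨_, hS a⟩ : S)) = LieHom.id := by
    ext a
    simp
  rw [eq_top_iff]
  intro x _
  have := LieHom.congr_fun h x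
  rw [LieHom.id_apply] at this
  rw [← this]
  exact (FreeLieAlgebra.lift K (fun a => (⟨_, hS a⟩ : S)) x).2

theorem span_range_leftGreedy (A : Type u) [LinearOrder A] :
    ⊤ ≤ Submodule.span K (Set.range fun w : LyndonWord A => toLie K (leftGreedy w)) := by
  rw [← span_range_toLie, Submodule.span_le]
  rintro _ ⟨L, rfl⟩
  refine Submodule.span_mono ?_ (toLie_mem_span_leftGreedy K _ L rfl)
  rintro _ ⟨w, -, rfl⟩
  exact ⟨w, rfl⟩

end Spanning

/-! ### The basis, its dual functionals and the projection formula. -/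

section Dual
variable (K : Type v) [Field K] [CharZero K] {A : Type u}

/-- The linear functional on the free Lie algebra given by the configuration pairing with a
graph. -/
noncomputable def pairingDual (G : LetterGraph A) : Module.Dual K (FreeLieAlgebra K A) :=
  have := G.finite
  have := Fintype.ofFinite G.V
  { toFun := fun x => pairingHom G.graph.Adj G.label K x Finset.univ
    map_add' := fun x y => by rw [map_add, VertexFun.add_apply]
    map_smul' := fun c x => by rw [map_smul, VertexFun.smul_apply]; rfl }

theorem pairingDual_toLie (G : LetterGraph A) (L : FreeMagma A) :
    pairingDual K G (toLie K L) = (pairing G L : K) := by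
  have := G.finite
  let := Fintype.ofFinite G.V
  rw [pairing_eq_subPairing]
  exact pairingHom_toLie G.graph.Adj G.label K L Finset.univ

variable [LinearOrder A]

theorem pairing_self_ne_zero (w : LyndonWord A) :
    (pairing (starGraph w) (leftGreedy w) : K) ≠ 0 :=
  Int.cast_ne_zero.2 ((pairing_ne_zero_iff _ w w rfl).2 rfl)

theorem pairing_eq_zero {w w' : LyndonWord A} (h : w ≠ w') :
    pairing (starGraph w) (leftGreedy w') = 0 :=
  not_not.1 fun h' => h ((pairing_ne_zero_iff _ w w' rfl).1 h')

/-- Diagonality isolates a single coefficient; linear independence is the case of a vanishing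
combination. -/
theorem pairingDual_linearCombination (w : LyndonWord A) (l : LyndonWord A →₀ K) :
    pairingDual K (starGraph w)
      (Finsupp.linearCombination K (fun w : LyndonWord A => toLie K (leftGreedy w)) l) =
      l w * (pairing (starGraph w) (leftGreedy w) : K) := by
  rw [Finsupp.linearCombination_apply, map_finsuppSum, Finsupp.sum_eq_single w]
  · rw [map_smul, pairingDual_toLie, smul_eq_mul]
  · intro w' _ h
    rw [map_smul, pairingDual_toLie, pairing_eq_zero h.symm, Int.cast_zero, smul_zero]
  · simp

variable (A) in
/-- The left-greedy basis of the free Lie algebra. -/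
noncomputable def leftGreedyBasis : Module.Basis (LyndonWord A) K (FreeLieAlgebra K A) :=
  Module.Basis.mk (v := fun w => toLie K (leftGreedy w))
    (linearIndependent_iff.2 fun l hl => by
      ext w
      have h := pairingDual_linearCombination K w l
      rw [hl, map_zero] at h
      exact (mul_eq_zero.1 h.symm).resolve_right (pairing_self_ne_zero K w))
    (span_range_leftGreedy K A)

theorem leftGreedyBasis_apply (w : LyndonWord A) :
    leftGreedyBasis K A w = toLie K (leftGreedy w) :=
  Module.Basis.mk_apply _ _ w

theorem leftGreedyBasis_coord (w : LyndonWord A) :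
    (leftGreedyBasis K A).coord w =
      (pairing (starGraph w) (leftGreedy w) : K)⁻¹ • pairingDual K (starGraph w) := by
  refine (leftGreedyBasis K A).ext fun w' => ?_
  rw [Module.Basis.coord_apply, Module.Basis.repr_self, LinearMap.smul_apply,
    leftGreedyBasis_apply, pairingDual_toLie, smul_eq_mul]
  by_cases h : w = w'
  · subst h
    rw [Finsupp.single_eq_same, inv_mul_cancel₀ (pairing_self_ne_zero K w)]
  · rw [Finsupp.single_eq_of_ne h, pairing_eq_zero h, Int.cast_zero, mul_zero]

theorem leftGreedyBasis_repr_toLie (L : FreeMagma A) (w : LyndonWord A) :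
    (leftGreedyBasis K A).repr (toLie K L) w =
      (pairing (starGraph w) L : K) / (pairing (starGraph w) (leftGreedy w) : K) := by
  rw [← Module.Basis.coord_apply, leftGreedyBasis_coord, LinearMap.smul_apply, pairingDual_toLie,
    smul_eq_mul, div_eq_inv_mul]

theorem finite_pairing_ne_zero (L : FreeMagma A) :
    {w : LyndonWord A | pairing (starGraph w) L ≠ 0}.Finite := by
  -- The pairings are integers, so the finite support over `ℚ` settles a statement that mentions no
  -- field.
  refine ((leftGreedyBasis ℚ A).repr (toLie ℚ L)).support.finite_toSet.subset fun w hw => ?_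
  rw [Finset.mem_coe, Finsupp.mem_support_iff, leftGreedyBasis_repr_toLie]
  exact div_ne_zero (Int.cast_ne_zero.2 hw) (pairing_self_ne_zero ℚ w)

theorem toLie_eq_finsum (L : FreeMagma A) :
    toLie K L = ∑ᶠ w : LyndonWord A,
      ((pairing (starGraph w) L : K) / (pairing (starGraph w) (leftGreedy w) : K)) •
        toLie K (leftGreedy w) := by
  simp only [← leftGreedyBasis_repr_toLie, ← leftGreedyBasis_apply]
  rw [finsum_eq_sum_of_support_subset (s := ((leftGreedyBasis K A).repr (toLie K L)).support)]
  · exact ((leftGreedyBasis K A).linearCombination_repr (toLie K L)).symm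
  · intro w hw
    rw [Finset.mem_coe, Finsupp.mem_support_iff]
    intro h
    exact hw (by simp only [h, zero_smul])

end Dual

end LeftGreedy

open LeftGreedy
theorem mainTheorem3 {K : Type*} [Field K] [CharZero K] {A : Type*} [LinearOrder A] :
    -- the denominators are nonzero, and the pairing is diagonal
    (∀ w w' : LyndonWord A, pairing (starGraph w) (leftGreedy w') ≠ 0 ↔ w = w') ∧
    -- the projection formula, whose sum has only finitely many nonzero coefficients
    (∀ L : FreeMagma A,
      {w : LyndonWord A | pairing (starGraph w) L ≠ 0}.Finite ∧
      toLie K L = ∑ᶠ w : LyndonWord A,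
        ((pairing (starGraph w) L : K) / (pairing (starGraph w) (leftGreedy w) : K)) •
          toLie K (leftGreedy w)) ∧
    -- the left-greedy brackets form a basis of the free Lie algebra; pairing with the star graphs
    -- gives well-defined linear functionals, which are, up to normalization, the dual basis
    (∃ (b : Module.Basis (LyndonWord A) K (FreeLieAlgebra K A))
        (φ : LyndonWord A → Module.Dual K (FreeLieAlgebra K A)),
      (∀ w, b w = toLie K (leftGreedy w)) ∧
      (∀ w L, φ w (toLie K L) = (pairing (starGraph w) L : K)) ∧
      (∀ w, b.coord w = (pairing (starGraph w) (leftGreedy w) : K)⁻¹ • φ w)) := by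
  exact ⟨fun w w' => pairing_ne_zero_iff _ w w' rfl,
    fun L => ⟨finite_pairing_ne_zero L, toLie_eq_finsum K L⟩,
    leftGreedyBasis K A, fun w => pairingDual K (starGraph w), leftGreedyBasis_apply K,
    fun w L => pairingDual_toLie K (starGraph w) L, leftGreedyBasis_coord K⟩
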